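/- Let $\Gamma$ be a metric graph, i.e. the compact connected metric space obtained from a finite connected multigraph (loops and multiple edges allowed) by assigning a positive real length to each edge, and let $g=\dim H_1(\Gamma,\mathbb{R})$ be its genus. A divisor on $\Gamma$ is a finite formal $\mathbb{Z}$-linear combination of points; two divisors are equivalent if they differ by the divisor of a continuous piecewise linear function with integer slopes (whose order at a point is the sum of its outgoing slopes). A divisor $D$ has rank at least $r\ge 0$ if $D-E$ is equivalent to an effective divisor for every effective divisor $E$ of degree $r$, and it has rank $r$ if it has rank at least $r$ but not at least $r+1$. $\Gamma$ is called hyperelliptic if it has a divisor of degree $2$ and rank $1$. Let $W^r_d(\Gamma)$ be the set of classes of divisors of degree $d$ and rank at least $r$, regarded via the Abel--Jacobi map as a subset of the Jacobian $H_1(\Gamma,\mathbb{R})^*/H_1(\Gamma,\mathbb{Z})$, a real torus of dimension $g$. Theorem. 1. Let $\Gamma$ be a metric graph of genus $g$ and let $r,d$ be integers with $0<2r\le d<g$. Then $\dim W^r_d(\Gamma)\le d-2r$ (the empty set having dimension $-\infty$). If $\Gamma$ is hyperelliptic, then $\dim W^r_d(\Gamma)= d-2r$; in particular, $W^r_d(\Gamma)$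 is then non-empty. 2. There exist a metric graph $\Gamma$ of some genus $g$ that is not hyperelliptic and integers $r,d$ with $0<2r\le d<g$ such that $\dim W^r_d(\Gamma)=d-2r$. -/

import Mathlib

open scoped Topology ENNReal

universe u

/-- A (compact, connected) metric graph, presented by a finite connected multigraph with loops and
multiple edges allowed, whose edges are oriented arbitrarily and carry positive real lengths. -/
structure MetricGraph where
  V : Type u
  E : Type u
  [fintypeV : Fintype V]
  [decEqV : DecidableEq V]
  [fintypeE : Fintype E]
  [decEqE : DecidableEq E]
  [nonemptyV : Nonempty V]
  src : E → V
  tgt : E → V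
  len : E → ℝ
  len_pos : ∀ e, 0 < len e
  connected : ∀ u v : V, Relation.EqvGen (fun a b => ∃ e, src e = a ∧ tgt e = b) u v

attribute [instance] MetricGraph.fintypeV MetricGraph.decEqV MetricGraph.fintypeE
  MetricGraph.decEqE MetricGraph.nonemptyV

noncomputable section

namespace MetricGraph

variable (Γ : MetricGraph.{u})

/-- The points of the metric graph: the vertices and the interior points of the edges; the point
`(e, t)` lies on `e` at distance `t` from `src e`. -/
abbrev Point : Type _ := Γ.V ⊕ (Σ e : Γ.E, Set.Ioo (0 : ℝ) (Γ.len e))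

/-- The parametrization `[0, len e] → Γ` of the closed edge `e` by arc length (extended by the
end points of `e` outside of that interval). -/
def edgePoint (e : Γ.E) (t : ℝ) : Γ.Point :=
  if h : t ∈ Set.Ioo (0 : ℝ) (Γ.len e) then Sum.inr ⟨e, ⟨t, h⟩⟩
  else if t ≤ 0 then Sum.inl (Γ.src e) else Sum.inl (Γ.tgt e)

/-! ### Divisors, rational functions, linear equivalence, rank -/

abbrev Divisor : Type _ := Γ.Point →₀ ℤ

variable {Γ}

def degree (D : Γ.Divisor) : ℤ := D.sum fun _ n => n

variable (Γ)

/-- A rational function: a real function which at every point and in every direction is locally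
affine with integer slope. (As the closed edges are compact, this means: continuous and piecewise
affine on every edge, with finitely many pieces and integer slopes.)
`rightSlope e t` and `leftSlope e t` are the slopes at the point of `e` with parameter `t` in the
directions of increasing and of decreasing parameter, respectively. -/
structure RationalFunction where
  toFun : Γ.Point → ℝ
  rightSlope : Γ.E → ℝ → ℤ
  leftSlope : Γ.E → ℝ → ℤ
  right_affine : ∀ e, ∀ t ∈ Set.Ico (0 : ℝ) (Γ.len e), ∀ᶠ s in 𝓝[>] t,
    toFun (Γ.edgePoint e s) = toFun (Γ.edgePoint e t) + (rightSlope e t : ℝ) * (s - t)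
  left_affine : ∀ e, ∀ t ∈ Set.Ioc (0 : ℝ) (Γ.len e), ∀ᶠ s in 𝓝[<] t,
    toFun (Γ.edgePoint e s) = toFun (Γ.edgePoint e t) + (leftSlope e t : ℝ) * (t - s)

variable {Γ}

/-- The order of a rational function at a point: the sum of all outgoing slopes. -/
def RationalFunction.ord (f : Γ.RationalFunction) : Γ.Point → ℤ
  | Sum.inl v => ∑ e : Γ.E, ((if Γ.src e = v then f.rightSlope e 0 else 0)
      + (if Γ.tgt e = v then f.leftSlope e (Γ.len e) else 0))
  | Sum.inr ⟨e, t⟩ => f.rightSlope e t + f.leftSlope e t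

/-- Linear equivalence: `D' = D + div f` for a rational function `f`. -/
def LinearlyEquivalent (D D' : Γ.Divisor) : Prop :=
  ∃ f : Γ.RationalFunction, ∀ x, D' x = D x + f.ord x

/-- The Baker–Norine rank of `D` is at least `k`: for every effective `E` of degree `k`, the
divisor `D - E` is equivalent to an effective divisor. -/
def RankAtLeast (D : Γ.Divisor) (k : ℕ) : Prop :=
  ∀ E : Γ.Divisor, 0 ≤ E → degree E = k → ∃ D' : Γ.Divisor, 0 ≤ D' ∧ LinearlyEquivalent (D - E) D'

/-- The Baker–Norine rank of `D` equals `k`. -/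
def HasRank (D : Γ.Divisor) (k : ℕ) : Prop :=
  RankAtLeast D k ∧ ¬ RankAtLeast D (k + 1)

variable (Γ)

/-- A metric graph is hyperelliptic if it has a divisor of degree 2 and rank 1. -/
def IsHyperelliptic : Prop := ∃ D : Γ.Divisor, degree D = 2 ∧ HasRank D 1

/-! ### Homology, the Jacobian and the Abel–Jacobi map -/

/-- The boundary of a 1-chain. -/
def boundary (R : Type*) [CommRing R] : (Γ.E → R) →ₗ[R] (Γ.V → R) where
  toFun c v := ∑ e, ((if Γ.tgt e = v then c e else 0) - (if Γ.src e = v then c e else 0))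
  map_add' a b := by
    funext v
    simp only [Pi.add_apply, ← Finset.sum_add_distrib]
    refine Finset.sum_congr rfl fun e _ => ?_
    split_ifs <;> ring
  map_smul' a b := by
    funext v
    simp only [Pi.smul_apply, smul_eq_mul, Finset.mul_sum, RingHom.id_apply]
    refine Finset.sum_congr rfl fun e _ => ?_
    split_ifs <;> ring

/-- `H₁(Γ, ℝ)`, the space of real 1-cycles. A cycle `ω` is also regarded as the harmonic 1-form
that equals `ω e · dt` on the edge `e`. -/
abbrev H1 : Submodule ℝ (Γ.E → ℝ) := LinearMap.ker (Γ.boundary ℝ)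

/-- The genus: the first Betti number. -/
def genus : ℕ := Module.finrank ℝ Γ.H1

/-- The universal cover `H₁(Γ, ℝ)*` of the Jacobian `H₁(Γ, ℝ)* / H₁(Γ, ℤ)`, where an integral cycle
`c` acts by `ω ↦ ∫_c ω = ∑ e, c e * len e * ω e`. -/
abbrev JacCover : Type _ := StrongDual ℝ Γ.H1

variable {Γ}

/-- The vertex from which the position of a point is measured. -/
def root : Γ.Point → Γ.V
  | Sum.inl v => v
  | Sum.inr ⟨e, _⟩ => Γ.src e

/-- The integral of a harmonic 1-form from `root x` to `x` along the edge that contains `x`. -/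
def rootIntegral (ω : Γ.H1) : Γ.Point → ℝ
  | Sum.inl _ => 0
  | Sum.inr ⟨e, t⟩ => (t : ℝ) * (ω : Γ.E → ℝ) e

/-- `ξ` is a lift to `H₁(Γ, ℝ)*` of the image of `D` under the Abel–Jacobi map with base point `v₀`,
that is, `ξ` is integration along some 1-chain with integral coefficients whose boundary is
`D - deg(D) v₀`. Such a chain consists of `D x` times the segment from `root x` to `x`, for each
point `x`, and of an integral combination `c` of edges. Any two lifts of `D` differ by an element
of the lattice `H₁(Γ, ℤ)`, and all such elements occur. -/
def IsAbelJacobiLift (v₀ : Γ.V) (D : Γ.Divisor) (ξ : Γ.JacCover) : Prop :=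
  ∃ c : Γ.E → ℤ,
    (∀ v, Γ.boundary ℤ c v =
      (D.sum fun x n => if root x = v then n else 0) - (if v = v₀ then degree D else 0)) ∧
    ∀ ω : Γ.H1, ξ ω = ∑ e, (c e : ℝ) * Γ.len e * (ω : Γ.E → ℝ) e
      + D.sum fun x n => (n : ℝ) * rootIntegral ω x

variable (Γ)

/-- The preimage in `H₁(Γ, ℝ)*` of the Brill–Noether locus `W^r_d(Γ)`, the set of classes of
divisors of degree `d` and rank at least `r`, which is regarded as a subset of the Jacobian through
the Abel–Jacobi map with base point `v₀`. -/
def brillNoetherLift (v₀ : Γ.V) (r d : ℕ) : Set Γ.JacCover :=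
  {ξ | ∃ D : Γ.Divisor, degree D = d ∧ RankAtLeast D r ∧ IsAbelJacobiLift v₀ D ξ}

open Classical in
/-- The dimension of `W^r_d(Γ)`, with value `⊥` for the empty set. The projection from
`H₁(Γ, ℝ)*` to the Jacobian is a covering, so the dimension can be computed upstairs; it is taken
to be the Hausdorff dimension, which for a locally finite union of polytopes is the largest
dimension of a cell. -/
def brillNoetherDim (v₀ : Γ.V) (r d : ℕ) : WithBot ℝ≥0∞ :=
  if (Γ.brillNoetherLift v₀ r d).Nonempty then
    ((dimH (Γ.brillNoetherLift v₀ r d) : ℝ≥0∞) : WithBot ℝ≥0∞)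
  else ⊥

end MetricGraph

end

/-! Upper bound. By Abel's theorem, proved in both directions, linear equivalence of divisors of
equal degree is equality in the Jacobian. In `H₁(Γ, ℝ)*` a point moving along an edge `e` moves its
lift along the line spanned by `edgeDual e`. Hence the lifts of effective divisors of degree `n` lie
in countably many translates, by integral chains, of subspaces spanned by at most `n` of the
`edgeDual e`.

Let `ξ` lift a class of degree `d` and rank at least `r`, and subtract `r` points moving on
prescribed edges `τ`. The resulting box is covered by countably many translates of such subspaces
with `n = d - r`. One of them meets the box parameters in positive measure, so its direction `W`
contains `edgeDual (τ j)` for all `j`, and `ξ` itself lies in a translate of `W` that does not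
depend on `ξ` (`exists_span_le_of_box_subset`). Doing this for every `τ` gives a choice `σ` of one
subspace per tuple; there are countably many `σ`, and the `ξ` with a given `σ` lie in one translate
of the intersection `L` of the chosen subspaces. The functionals `edgeDual e` span a space of
dimension `g > d - r`, so some `τ` adds `r` dimensions to `L` inside its `W`. Thus `dim L + r ≤ d -
r` (`dimH_le_of_forall_tuple`).

Equality. If `D` has degree 2 and rank 1, then `r • D` plus `d - 2r` arbitrary points has rank at
least `r`. Moving these points on edges with independent `edgeDual`s sweeps out a box of dimension
`d - 2r`.

Part 2. Take `loopedCycle`, `r = 1`, `d = 3`. Two mirror points on a loop are equivalent to twice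
its base point, so every degree 3 divisor on the cycle has rank at least 1; these classes form a
circle. A divisor of degree 2 and rank 1 would make twice one attaching point and twice the other
agree on the cycle, but they are at distance 1 on a circle of length 3. -/

noncomputable section

namespace MetricGraph

variable {Γ : MetricGraph.{u}}

/-! ### Lifts of divisors under the Abel–Jacobi map -/

/-- The functional `ω ↦ ω e`. -/
def edgeDual (e : Γ.E) : Γ.JacCover :=
  (ContinuousLinearMap.proj e).comp Γ.H1.subtypeL

@[simp] lemma edgeDual_apply (e : Γ.E) (ω : Γ.H1) : edgeDual e ω = (ω : Γ.E → ℝ) e := rfl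

/-- Integration along an integral 1-chain. -/
def chainDual (c : Γ.E → ℤ) : Γ.JacCover := ∑ e, ((c e : ℝ) * Γ.len e) • edgeDual e

lemma chainDual_apply (c : Γ.E → ℤ) (ω : Γ.H1) :
    chainDual c ω = ∑ e, (c e : ℝ) * Γ.len e * (ω : Γ.E → ℝ) e := by
  simp [chainDual]

/-- Integration along the segment from `root x` to `x`. -/
def rootDual : Γ.Point → Γ.JacCover
  | Sum.inl _ => 0
  | Sum.inr ⟨e, t⟩ => (t : ℝ) • edgeDual e

lemma rootDual_apply (ω : Γ.H1) (x : Γ.Point) : rootDual x ω = rootIntegral ω x := by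
  rcases x with v | ⟨e, t⟩ <;> simp [rootDual, rootIntegral]

/-- The push-forward of a divisor along `root`. -/
def rootDegree (D : Γ.Divisor) (v : Γ.V) : ℤ := D.sum fun x n => if root x = v then n else 0

/-- Integration along the segments from `root x` to `x`, weighted by `D`. -/
def divisorDual (D : Γ.Divisor) : Γ.JacCover := D.sum fun x n => (n : ℝ) • rootDual x

lemma degree_add (D D' : Γ.Divisor) : degree (D + D') = degree D + degree D' :=
  Finsupp.sum_add_index' (fun _ => rfl) fun _ _ _ => rfl

@[simp] lemma degree_single (x : Γ.Point) (n : ℤ) : degree (Finsupp.single x n) = n :=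
  Finsupp.sum_single_index rfl

@[simp] lemma degree_zero : degree (0 : Γ.Divisor) = 0 := Finsupp.sum_zero_index

lemma degree_neg (D : Γ.Divisor) : degree (-D) = -degree D := by
  have := degree_add D (-D)
  simp at this
  linarith

lemma degree_sub (D D' : Γ.Divisor) : degree (D - D') = degree D - degree D' := by
  rw [sub_eq_add_neg, degree_add, degree_neg, sub_eq_add_neg]

lemma degree_sum {ι : Type*} (s : Finset ι) (D : ι → Γ.Divisor) :
    degree (∑ i ∈ s, D i) = ∑ i ∈ s, degree (D i) := by
  classical
  induction s using Finset.induction_on with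
  | empty => simp
  | insert i s hi ih => rw [Finset.sum_insert hi, Finset.sum_insert hi, degree_add, ih]

lemma rootDegree_add (D D' : Γ.Divisor) : rootDegree (D + D') = rootDegree D + rootDegree D' := by
  funext v
  exact Finsupp.sum_add_index' (fun _ => by simp) fun _ _ _ => by split_ifs <;> simp

lemma rootDegree_single (x : Γ.Point) (n : ℤ) (v : Γ.V) :
    rootDegree (Finsupp.single x n) v = if root x = v then n else 0 :=
  Finsupp.sum_single_index (by simp)

lemma divisorDual_add (D D' : Γ.Divisor) :
    divisorDual (D + D') = divisorDual D + divisorDual D' :=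
  Finsupp.sum_add_index' (fun _ => by simp) fun _ _ _ => by push_cast; rw [add_smul]

lemma divisorDual_single (x : Γ.Point) (n : ℤ) :
    divisorDual (Finsupp.single x n) = (n : ℝ) • rootDual x :=
  Finsupp.sum_single_index (by simp)

lemma chainDual_add (c c' : Γ.E → ℤ) : chainDual (c + c') = chainDual c + chainDual c' := by
  simp [chainDual, ← Finset.sum_add_distrib, add_mul, add_smul]

lemma chainDual_neg (c : Γ.E → ℤ) : chainDual (-c) = -chainDual c := by
  ext ω
  simp [chainDual]

lemma sum_rootDegree (D : Γ.Divisor) : ∑ v, rootDegree D v = degree D := by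
  simp only [rootDegree, Finsupp.sum, degree]
  rw [Finset.sum_comm]
  simp

lemma sum_boundary (c : Γ.E → ℤ) : ∑ v, Γ.boundary ℤ c v = 0 := by
  simp only [boundary, LinearMap.coe_mk, AddHom.coe_mk]
  rw [Finset.sum_comm]
  simp [Finset.sum_sub_distrib]

lemma isAbelJacobiLift_iff {v₀ : Γ.V} {D : Γ.Divisor} {ξ : Γ.JacCover} :
    IsAbelJacobiLift v₀ D ξ ↔ ∃ c : Γ.E → ℤ,
      (Γ.boundary ℤ c = rootDegree D - Pi.single v₀ (degree D)) ∧
        ξ = chainDual c + divisorDual D := by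
  refine exists_congr fun c => and_congr ?_ ?_
  · rw [funext_iff]
    refine forall_congr' fun v => ?_
    simp [rootDegree, Pi.single_apply]
  · rw [ContinuousLinearMap.ext_iff]
    refine forall_congr' fun ω => ?_
    simp [chainDual, divisorDual, Finsupp.sum, rootDual_apply]

lemma IsAbelJacobiLift.add {v₀ : Γ.V} {D D' : Γ.Divisor} {ξ ξ' : Γ.JacCover}
    (h : IsAbelJacobiLift v₀ D ξ) (h' : IsAbelJacobiLift v₀ D' ξ') :
    IsAbelJacobiLift v₀ (D + D') (ξ + ξ') := by
  rw [isAbelJacobiLift_iff] at *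
  obtain ⟨c, hc, rfl⟩ := h
  obtain ⟨c', hc', rfl⟩ := h'
  refine ⟨c + c', ?_, ?_⟩
  · rw [map_add, hc, hc', rootDegree_add, degree_add, Pi.single_add]
    abel
  · rw [chainDual_add, divisorDual_add]
    abel

lemma isAbelJacobiLift_zero (v₀ : Γ.V) : IsAbelJacobiLift v₀ (0 : Γ.Divisor) 0 := by
  rw [isAbelJacobiLift_iff]
  refine ⟨0, ?_, ?_⟩
  · rw [map_zero, degree_zero, Pi.single_zero, sub_zero]; rfl
  · simp [chainDual, divisorDual]

lemma IsAbelJacobiLift.neg {v₀ : Γ.V} {D : Γ.Divisor} {ξ : Γ.JacCover}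
    (h : IsAbelJacobiLift v₀ D ξ) : IsAbelJacobiLift v₀ (-D) (-ξ) := by
  rw [isAbelJacobiLift_iff] at *
  obtain ⟨c, hc, rfl⟩ := h
  have h1 : rootDegree (-D) = -rootDegree D := by
    have := rootDegree_add D (-D)
    rw [add_neg_cancel] at this
    exact (neg_eq_of_add_eq_zero_right this.symm).symm
  have h2 : divisorDual (-D) = -divisorDual D := by
    have h := divisorDual_add D (-D)
    rw [add_neg_cancel] at h
    have h0 : divisorDual (0 : Γ.Divisor) = 0 := Finsupp.sum_zero_index
    ext ω
    have := congrArg (fun ξ : Γ.JacCover => ξ ω) (h0.symm.trans h)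
    simp only [zero_apply, add_apply, neg_apply] at this ⊢
    linarith
  refine ⟨-c, ?_, ?_⟩
  · rw [map_neg, hc, h1, degree_neg, Pi.single_neg]
    abel
  · rw [chainDual_neg, h2]
    abel

lemma IsAbelJacobiLift.sub {v₀ : Γ.V} {D D' : Γ.Divisor} {ξ ξ' : Γ.JacCover}
    (h : IsAbelJacobiLift v₀ D ξ) (h' : IsAbelJacobiLift v₀ D' ξ') :
    IsAbelJacobiLift v₀ (D - D') (ξ - ξ') := by
  have hξ : ξ - ξ' = ξ + -ξ' := by ext ω; simp [sub_eq_add_neg]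
  rw [sub_eq_add_neg, hξ]
  exact h.add h'.neg

lemma IsAbelJacobiLift.sum {ι : Type*} {v₀ : Γ.V} (s : Finset ι) {D : ι → Γ.Divisor}
    {ξ : ι → Γ.JacCover} (h : ∀ i ∈ s, IsAbelJacobiLift v₀ (D i) (ξ i)) :
    IsAbelJacobiLift v₀ (∑ i ∈ s, D i) (∑ i ∈ s, ξ i) := by
  classical
  induction s using Finset.induction_on with
  | empty => exact isAbelJacobiLift_zero v₀
  | insert i s hi ih =>
    rw [Finset.sum_insert hi, Finset.sum_insert hi]
    exact (h i (Finset.mem_insert_self i s)).add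
      (ih fun j hj => h j (Finset.mem_insert_of_mem hj))

lemma isAbelJacobiLift_chainDual (v₀ : Γ.V) {c : Γ.E → ℤ} (hc : Γ.boundary ℤ c = 0) :
    IsAbelJacobiLift v₀ (0 : Γ.Divisor) (chainDual c) := by
  rw [isAbelJacobiLift_iff]
  refine ⟨c, ?_, ?_⟩
  · rw [hc, degree_zero, Pi.single_zero, sub_zero]; rfl
  · simp [divisorDual]

lemma boundary_single (R : Type*) [CommRing R] (e : Γ.E) :
    Γ.boundary R (Pi.single e 1) = Pi.single (Γ.tgt e) 1 - Pi.single (Γ.src e) 1 := by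
  funext v
  simp only [boundary, LinearMap.coe_mk, AddHom.coe_mk, Pi.sub_apply, Pi.single_apply,
    Finset.sum_sub_distrib]
  congr 1
  · rw [Finset.sum_eq_single e] <;> simp +contextual [eq_comm]
  · rw [Finset.sum_eq_single e] <;> simp +contextual [eq_comm]

lemma exists_boundary_eq (u v : Γ.V) :
    ∃ c : Γ.E → ℤ, Γ.boundary ℤ c = Pi.single v 1 - Pi.single u 1 := by
  have h := Γ.connected u v
  induction h with
  | rel a b h =>
    obtain ⟨e, rfl, rfl⟩ := h
    exact ⟨_, boundary_single ℤ e⟩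
  | refl a => exact ⟨0, by simp⟩
  | symm a b _ ih =>
    obtain ⟨c, hc⟩ := ih
    exact ⟨-c, by rw [map_neg, hc]; abel⟩
  | trans a b d _ _ ih ih' =>
    obtain ⟨c, hc⟩ := ih
    obtain ⟨c', hc'⟩ := ih'
    exact ⟨c + c', by rw [map_add, hc, hc']; abel⟩

lemma isAbelJacobiLift_single {v₀ : Γ.V} {x : Γ.Point} {c : Γ.E → ℤ}
    (hc : Γ.boundary ℤ c = Pi.single (root x) 1 - Pi.single v₀ 1) :
    IsAbelJacobiLift v₀ (Finsupp.single x 1) (chainDual c + rootDual x) := by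
  rw [isAbelJacobiLift_iff]
  refine ⟨c, ?_, ?_⟩
  · rw [hc, degree_single]
    congr 1
    funext v
    rw [rootDegree_single, Pi.single_apply]
    simp [eq_comm]
  · rw [divisorDual_single]; simp

lemma exists_isAbelJacobiLift_single (v₀ : Γ.V) (x : Γ.Point) :
    ∃ ξ, IsAbelJacobiLift v₀ (Finsupp.single x 1) ξ := by
  obtain ⟨c, hc⟩ := exists_boundary_eq v₀ (root x)
  exact ⟨_, isAbelJacobiLift_single hc⟩

lemma edgePoint_of_mem {e : Γ.E} {t : ℝ} (ht : t ∈ Set.Ioo (0 : ℝ) (Γ.len e)) :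
    Γ.edgePoint e t = Sum.inr ⟨e, ⟨t, ht⟩⟩ := dif_pos ht

lemma edgePoint_zero (e : Γ.E) : Γ.edgePoint e 0 = Sum.inl (Γ.src e) := by
  simp [edgePoint]

lemma edgePoint_len (e : Γ.E) : Γ.edgePoint e (Γ.len e) = Sum.inl (Γ.tgt e) := by
  simp [edgePoint, Γ.len_pos e]

lemma IsAbelJacobiLift.edgePoint {v₀ : Γ.V} {e : Γ.E} {κ : Γ.JacCover}
    (h : IsAbelJacobiLift v₀ (Finsupp.single (Sum.inl (Γ.src e)) 1) κ) {t : ℝ}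
    (ht : t ∈ Set.Icc (0 : ℝ) (Γ.len e)) :
    IsAbelJacobiLift v₀ (Finsupp.single (Γ.edgePoint e t) 1) (κ + t • edgeDual e) := by
  rw [isAbelJacobiLift_iff] at h
  obtain ⟨c, hc, rfl⟩ := h
  have hr : rootDegree (Finsupp.single (Sum.inl (Γ.src e) : Γ.Point) 1) =
      Pi.single (Γ.src e) 1 := by
    funext v
    rw [rootDegree_single, Pi.single_apply]
    simp [root, eq_comm]
  rw [hr, degree_single] at hc
  rw [divisorDual_single]
  simp only [rootDual, smul_zero, add_zero]
  rcases ht.1.eq_or_lt with rfl | h0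
  · rw [edgePoint_zero]
    simpa [rootDual] using isAbelJacobiLift_single (x := Sum.inl (Γ.src e)) hc
  rcases ht.2.eq_or_lt with rfl | h1
  · rw [edgePoint_len]
    -- The end point `t = len e` is a vertex with itself as root, so the whole edge has to move from
    -- the root segment into the integral chain.
    have hc' : Γ.boundary ℤ (c + Pi.single e 1) =
        Pi.single (root (Sum.inl (Γ.tgt e) : Γ.Point)) 1 - Pi.single v₀ 1 := by
      rw [map_add, hc, boundary_single ℤ, root]; abel
    have := isAbelJacobiLift_single hc'
    rw [chainDual_add] at this
    convert this using 1
    simp only [rootDual, add_zero, chainDual]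
    congr 1
    rw [Finset.sum_eq_single e] <;> simp +contextual
  · rw [edgePoint_of_mem ⟨h0, h1⟩]
    exact isAbelJacobiLift_single (x := Sum.inr ⟨e, ⟨t, h0, h1⟩⟩) hc

lemma exists_isAbelJacobiLift (v₀ : Γ.V) (D : Γ.Divisor) : ∃ ξ, IsAbelJacobiLift v₀ D ξ := by
  have h1 : ∀ x (n : ℕ), ∃ ξ : Γ.JacCover, IsAbelJacobiLift v₀ (Finsupp.single x (n : ℤ)) ξ := by
    intro x n
    induction n with
    | zero => exact ⟨0, by simpa using isAbelJacobiLift_zero v₀⟩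
    | succ n ih =>
      obtain ⟨ξ, h⟩ := ih
      obtain ⟨ξ', h'⟩ := exists_isAbelJacobiLift_single v₀ x
      exact ⟨ξ + ξ', by push_cast; rw [Finsupp.single_add]; exact h.add h'⟩
  induction D using Finsupp.induction_linear with
  | zero => exact ⟨0, isAbelJacobiLift_zero v₀⟩
  | add D D' h h' =>
    obtain ⟨ξ, h⟩ := h
    obtain ⟨ξ', h'⟩ := h'
    exact ⟨_, h.add h'⟩
  | single x n =>
    obtain ⟨m, rfl | rfl⟩ := n.eq_nat_or_neg
    · exact h1 x m
    · obtain ⟨ξ, h⟩ := h1 x m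
      exact ⟨-ξ, by rw [Finsupp.single_neg]; exact h.neg⟩

lemma span_range_edgeDual : Submodule.span ℝ (Set.range (edgeDual (Γ := Γ))) = ⊤ := by
  rw [eq_top_iff]
  intro ξ _
  obtain ⟨φ, hφ⟩ := LinearMap.exists_extend (ξ : Γ.H1 →ₗ[ℝ] ℝ)
  have : ξ = ∑ e, φ (Pi.single e 1) • edgeDual e := by
    ext ω
    have h1 : φ (ω : Γ.E → ℝ) = ξ ω := LinearMap.congr_fun hφ ω
    rw [← h1]
    conv_lhs => rw [← Finset.univ_sum_single (ω : Γ.E → ℝ)]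
    rw [map_sum, sum_apply]
    refine Finset.sum_congr rfl fun e _ => ?_
    have : (Pi.single e ((ω : Γ.E → ℝ) e) : Γ.E → ℝ) = (ω : Γ.E → ℝ) e • Pi.single e 1 := by
      rw [← Pi.single_smul]; simp
    rw [this, map_smul]
    simp [mul_comm]
  rw [this]
  exact Submodule.sum_mem _ fun e _ => Submodule.smul_mem _ _ (Submodule.subset_span ⟨e, rfl⟩)

lemma finrank_jacCover : Module.finrank ℝ Γ.JacCover = Γ.genus := by
  rw [genus, ← Subspace.dual_finrank_eq (K := ℝ) (V := Γ.H1)]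
  exact (LinearMap.toContinuousLinearMap (𝕜 := ℝ) (E := Γ.H1) (F' := ℝ)).symm.finrank_eq

end MetricGraph

end

/-! ### Piecewise affine functions and divisors along an edge -/

noncomputable section

/-- A function with integral one-sided slopes that add up to zero at all inner points of an
interval is affine. -/
lemma affine_of_slopes_cancel {L : ℝ} (hL : 0 < L) {G : ℝ → ℝ} {R S : ℝ → ℤ}
    (hR : ∀ t ∈ Set.Ico (0 : ℝ) L, ∀ᶠ s in 𝓝[>] t, G s = G t + (R t : ℝ) * (s - t))
    (hS : ∀ t ∈ Set.Ioc (0 : ℝ) L, ∀ᶠ s in 𝓝[<] t, G s = G t + (S t : ℝ) * (t - s))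
    (h : ∀ t ∈ Set.Ioo (0 : ℝ) L, R t + S t = 0) :
    R 0 + S L = 0 ∧ G L = G 0 + R 0 * L := by
  have hr : ∀ t ∈ Set.Ico (0 : ℝ) L, HasDerivWithinAt G (R t : ℝ) (Set.Ici t) t := by
    intro t ht
    rw [← hasDerivWithinAt_Ioi_iff_Ici]
    have h1 : HasDerivWithinAt (fun s => G t + (R t : ℝ) * (s - t)) (R t : ℝ) (Set.Ioi t) t := by
      simpa using ((((hasDerivAt_id t).sub_const t).const_mul (R t : ℝ)).const_add
        (G t)).hasDerivWithinAt
    exact h1.congr_of_eventuallyEq (hR t ht) (by simp)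
  have hs : ∀ t ∈ Set.Ioc (0 : ℝ) L, HasDerivWithinAt G (-(S t : ℝ)) (Set.Iic t) t := by
    intro t ht
    rw [← hasDerivWithinAt_Iio_iff_Iic]
    have h1 : HasDerivWithinAt (fun s => G t + (S t : ℝ) * (t - s)) (-(S t : ℝ))
        (Set.Iio t) t := by
      simpa using ((((hasDerivAt_id t).const_sub t).const_mul (S t : ℝ)).const_add
        (G t)).hasDerivWithinAt
    exact h1.congr_of_eventuallyEq (hS t ht) (by simp)
  set G' : ℝ → ℤ := fun t => if t < L then R t else -S L with hG'
  have hd : ∀ t ∈ Set.Icc (0 : ℝ) L, HasDerivWithinAt G (G' t : ℝ) (Set.Icc 0 L) t := by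
    intro t ht
    rcases ht.2.eq_or_lt with rfl | h1
    · have := hs t ⟨hL, le_rfl⟩
      simp only [hG', lt_irrefl, if_false]
      push_cast
      exact this.mono fun s hs => hs.2
    have e1 : G' t = R t := by simp [hG', h1]
    rw [e1]
    rcases ht.1.eq_or_lt with rfl | h0
    · exact (hr 0 ⟨le_rfl, hL⟩).mono fun s hs => hs.1
    · have h2 := hs t ⟨h0, ht.2⟩
      have h3 : -(S t : ℝ) = R t := by
        have := h t ⟨h0, h1⟩
        have : ((R t + S t : ℤ) : ℝ) = 0 := by rw [this]; simp
        push_cast at this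
        linarith
      rw [h3] at h2
      exact (h2.union (hr t ⟨ht.1, h1⟩)).mono fun s _ => le_total s t
  -- Darboux: the derivative has the intermediate value property, and an integer-valued function
  -- with that property is constant.
  have hconv := (Set.ordConnected_Icc (a := (0 : ℝ)) (b := L)).image_hasDerivWithinAt hd
  have hc : ∀ s ∈ Set.Icc (0 : ℝ) L, ∀ t ∈ Set.Icc (0 : ℝ) L, ¬ G' s < G' t := by
    intro s hs t ht hlt
    have hlt' : (G' s : ℝ) + 1 ≤ G' t := by exact_mod_cast hlt
    obtain ⟨w, _, hw⟩ := hconv.out ⟨s, hs, rfl⟩ ⟨t, ht, rfl⟩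
      (⟨by linarith, by linarith⟩ : (G' s : ℝ) + 1 / 2 ∈ Set.Icc (G' s : ℝ) (G' t))
    have h2 : (2 * (G' w) : ℝ) = 2 * G' s + 1 := by simp only [hw]; ring
    have h3 : 2 * G' w = 2 * G' s + 1 := by exact_mod_cast h2
    omega
  have heq : ∀ s ∈ Set.Icc (0 : ℝ) L, ∀ t ∈ Set.Icc (0 : ℝ) L, G' s = G' t := fun s hs t ht =>
    le_antisymm (not_lt.1 (hc t ht s hs)) (not_lt.1 (hc s hs t ht))
  have h0 : (0 : ℝ) ∈ Set.Icc (0 : ℝ) L := ⟨le_rfl, hL.le⟩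
  have e0 : G' 0 = R 0 := by simp [hG', hL]
  constructor
  · have := heq 0 h0 L ⟨hL.le, le_rfl⟩
    simp only [hG', hL, if_true, lt_irrefl, if_false] at this
    omega
  · obtain ⟨w, hw, hw'⟩ := exists_hasDerivAt_eq_slope G (fun t => (G' t : ℝ)) hL
      (fun t ht => (hd t ht).continuousWithinAt)
      fun t ht => (hd t ⟨ht.1.le, ht.2.le⟩).hasDerivAt (Icc_mem_nhds ht.1 ht.2)
    simp only [heq w ⟨hw.1.le, hw.2.le⟩ 0 h0, e0, sub_zero] at hw'
    rw [hw']
    field_simp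
    ring

namespace MetricGraph

variable {Γ : MetricGraph.{u}}

/-- The extension by zero of a function of the parameter of an edge. -/
def onEdge {R : Type*} [Zero R] (e : Γ.E) (φ : ℝ → R) : Γ.Point → R
  | Sum.inl _ => 0
  | Sum.inr ⟨e', t⟩ => if e' = e then φ t else 0

/-- The sum of a function over the part of a divisor that lies in the interior of an edge. -/
def edgeSum {R : Type*} [CommRing R] (F : Γ.Divisor) (e : Γ.E) (φ : ℝ → R) : R :=
  F.sum fun x n => (n : R) * onEdge e φ x

section edgeSum

variable {R : Type*} [CommRing R]

lemma edgeSum_add (F F' : Γ.Divisor) (e : Γ.E) (φ : ℝ → R) :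
    edgeSum (F + F') e φ = edgeSum F e φ + edgeSum F' e φ :=
  Finsupp.sum_add_index' (fun _ => by simp) fun _ _ _ => by push_cast; rw [add_mul]

lemma edgeSum_single (x : Γ.Point) (n : ℤ) (e : Γ.E) (φ : ℝ → R) :
    edgeSum (Finsupp.single x n) e φ = n * onEdge e φ x :=
  Finsupp.sum_single_index (by simp)

lemma edgeSum_zero (e : Γ.E) (φ : ℝ → R) : edgeSum (0 : Γ.Divisor) e φ = 0 :=
  Finsupp.sum_zero_index

lemma edgeSum_congr (F : Γ.Divisor) (e : Γ.E) {φ ψ : ℝ → R}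
    (h : ∀ t ∈ Set.Ioo (0 : ℝ) (Γ.len e), φ t = ψ t) : edgeSum F e φ = edgeSum F e ψ := by
  refine Finsupp.sum_congr fun x _ => ?_
  rcases x with v | ⟨e', t, ht⟩
  · rfl
  · simp only [onEdge]
    split_ifs with he
    · subst he; rw [h t ht]
    · rfl

lemma edgeSum_const_zero (F : Γ.Divisor) (e : Γ.E) : edgeSum F e (fun _ => (0 : R)) = 0 := by
  refine Finset.sum_eq_zero fun x _ => ?_
  rcases x with v | ⟨e', t, ht⟩ <;> simp [onEdge]

end edgeSum

/-- Counting the points beyond `t` with and without `t` differs by the multiplicity at `t`. Together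
with the next slope formulas, this says that `s ↦ edgeSum F e (min s ·)` has order `-F` inside the
edge. -/
lemma edgeSum_lt_sub_edgeSum_le (F : Γ.Divisor) (e : Γ.E) {t : ℝ}
    (ht : t ∈ Set.Ioo (0 : ℝ) (Γ.len e)) :
    edgeSum F e (fun τ => if t < τ then (1 : ℤ) else 0) -
      edgeSum F e (fun τ => if t ≤ τ then (1 : ℤ) else 0) = -F (Sum.inr ⟨e, ⟨t, ht⟩⟩) := by
  induction F using Finsupp.induction_linear with
  | zero => simp [edgeSum_zero]
  | add F F' h h' =>
    rw [edgeSum_add, edgeSum_add, Finsupp.add_apply]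
    linarith
  | single x n =>
    rw [edgeSum_single, edgeSum_single]
    rcases x with v | ⟨e', t', ht'⟩
    · simp [onEdge]
    · simp only [onEdge, Int.cast_id]
      rw [Finsupp.single_apply]
      by_cases he : e' = e
      · subst he
        simp only [if_true, Sum.inr.injEq, Sigma.mk.injEq, heq_eq_eq, true_and, Subtype.mk.injEq]
        rcases lt_trichotomy t t' with h | h | h
        · simp [h, h.le, h.ne']
        · simp [h]
        · simp [h.not_gt, h.not_ge, h.ne]
      · have : (Sum.inr ⟨e', ⟨t', ht'⟩⟩ : Γ.Point) ≠ Sum.inr ⟨e, ⟨t, ht⟩⟩ := by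
          simp [he]
        simp [he]

lemma rootDegree_eq (F : Γ.Divisor) (v : Γ.V) :
    rootDegree F v = F (Sum.inl v) +
      ∑ e, if Γ.src e = v then edgeSum F e (fun _ => (1 : ℤ)) else 0 := by
  induction F using Finsupp.induction_linear with
  | zero => simp [edgeSum_zero, rootDegree]
  | add F F' h h' =>
    have h2 : (∑ e, if Γ.src e = v then edgeSum (F + F') e (fun _ => (1 : ℤ)) else 0) =
        (∑ e, if Γ.src e = v then edgeSum F e (fun _ => (1 : ℤ)) else 0) +
        ∑ e, if Γ.src e = v then edgeSum F' e (fun _ => (1 : ℤ)) else 0 := by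
      rw [← Finset.sum_add_distrib]
      refine Finset.sum_congr rfl fun e _ => ?_
      split_ifs <;> simp [edgeSum_add]
    rw [rootDegree_add, Pi.add_apply, h, h', h2, Finsupp.add_apply]
    ring
  | single x n =>
    rw [rootDegree_single]
    simp only [edgeSum_single]
    rcases x with w | ⟨e', t⟩
    · simp only [root, onEdge, Finsupp.single_apply, Sum.inl.injEq, mul_zero, ite_self,
        Finset.sum_const_zero, add_zero]
      congr
    · simp only [root, onEdge, Finsupp.single_apply]
      rw [Finset.sum_eq_single e'] <;> simp +contextual [eq_comm]

lemma divisorDual_apply (F : Γ.Divisor) (ω : Γ.H1) :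
    divisorDual F ω = ∑ e, edgeSum F e (fun t => t) * (ω : Γ.E → ℝ) e := by
  induction F using Finsupp.induction_linear with
  | zero => simp [edgeSum_zero, divisorDual]
  | add F F' h h' =>
    rw [divisorDual_add, add_apply, h, h', ← Finset.sum_add_distrib]
    simp [edgeSum_add, add_mul]
  | single x n =>
    rw [divisorDual_single]
    simp only [edgeSum_single]
    rcases x with w | ⟨e', t⟩
    · simp [rootDual, onEdge]
    · simp only [rootDual, onEdge]
      rw [Finset.sum_eq_single e'] <;> simp +contextual [eq_comm, mul_assoc]

/-- Summation by parts: boundary and coboundary are adjoint. -/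
lemma sum_mul_sub_eq (h : Γ.V → ℝ) (ω : Γ.E → ℝ) :
    ∑ e, (h (Γ.tgt e) - h (Γ.src e)) * ω e = ∑ v, h v * Γ.boundary ℝ ω v := by
  simp only [boundary, LinearMap.coe_mk, AddHom.coe_mk, Finset.mul_sum]
  rw [Finset.sum_comm]
  refine Finset.sum_congr rfl fun e _ => ?_
  simp [mul_sub, sub_mul]

lemma eventually_edgeSum_min_right (F : Γ.Divisor) (e : Γ.E) (t : ℝ) :
    ∀ᶠ s in 𝓝[>] t, edgeSum F e (fun τ => min s τ) = edgeSum F e (fun τ => min t τ) +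
      (edgeSum F e (fun τ => if t < τ then (1 : ℤ) else 0) : ℤ) * (s - t) := by
  have : ∀ x ∈ F.support, ∀ᶠ s in 𝓝[>] t, onEdge e (fun τ => min s τ) x =
      onEdge e (fun τ => min t τ) x +
        (onEdge e (fun τ => if t < τ then (1 : ℤ) else 0) x : ℤ) * (s - t) := by
    intro x _
    rcases x with v | ⟨e', t', ht'⟩
    · simp [onEdge]
    · simp only [onEdge]
      by_cases he : e' = e
      · simp only [he, if_true]
        by_cases h : t < t'
        · filter_upwards [Ioo_mem_nhdsGT h] with s hs
          simp [h, h.le, hs.2.le]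
        · filter_upwards [self_mem_nhdsWithin] with s hs
          have h' := not_lt.1 h
          rw [min_eq_right h', min_eq_right (h'.trans (le_of_lt hs))]
          simp [h]
      · simp [he]
  rw [← Filter.eventually_all_finset] at this
  filter_upwards [this] with s hs
  simp only [edgeSum, Finsupp.sum]
  push_cast
  rw [Finset.sum_mul, ← Finset.sum_add_distrib]
  refine Finset.sum_congr rfl fun x hx => ?_
  rw [hs x hx]
  ring

lemma eventually_edgeSum_min_left (F : Γ.Divisor) (e : Γ.E) (t : ℝ) :
    ∀ᶠ s in 𝓝[<] t, edgeSum F e (fun τ => min s τ) = edgeSum F e (fun τ => min t τ) -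
      (edgeSum F e (fun τ => if t ≤ τ then (1 : ℤ) else 0) : ℤ) * (t - s) := by
  have : ∀ x ∈ F.support, ∀ᶠ s in 𝓝[<] t, onEdge e (fun τ => min s τ) x =
      onEdge e (fun τ => min t τ) x -
        (onEdge e (fun τ => if t ≤ τ then (1 : ℤ) else 0) x : ℤ) * (t - s) := by
    intro x _
    rcases x with v | ⟨e', t', ht'⟩
    · simp [onEdge]
    · simp only [onEdge]
      by_cases he : e' = e
      · simp only [he, if_true]
        by_cases h : t ≤ t'
        · filter_upwards [self_mem_nhdsWithin] with s hs
          rw [min_eq_left h, min_eq_left ((le_of_lt hs).trans h)]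
          simp [h]
        · have h' := not_le.1 h
          filter_upwards [Ioo_mem_nhdsLT h'] with s hs
          rw [min_eq_right h'.le, min_eq_right hs.1.le]
          simp [h]
      · simp [he]
  rw [← Filter.eventually_all_finset] at this
  filter_upwards [this] with s hs
  simp only [edgeSum, Finsupp.sum]
  push_cast
  rw [Finset.sum_mul, ← Finset.sum_sub_distrib]
  refine Finset.sum_congr rfl fun x hx => ?_
  rw [hs x hx]
  ring

/-! ### Abel's theorem -/

lemma RationalFunction.slope_relation (f : Γ.RationalFunction) {F : Γ.Divisor}
    (hF : ∀ x, F x = f.ord x) (e : Γ.E) :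
    f.rightSlope e 0 + edgeSum F e (fun _ => (1 : ℤ)) + f.leftSlope e (Γ.len e) = 0 ∧
    f.toFun (Sum.inl (Γ.tgt e)) - f.toFun (Sum.inl (Γ.src e)) =
      -(f.leftSlope e (Γ.len e) * Γ.len e + edgeSum F e fun t => t) := by
  -- Adding `edgeSum F e (min s ·)` cancels every kink of `f` in the interior of `e`, so the sum is
  -- affine.
  have h := affine_of_slopes_cancel (Γ.len_pos e)
    (G := fun s => f.toFun (Γ.edgePoint e s) + edgeSum F e (fun τ => min s τ))
    (R := fun t => f.rightSlope e t + edgeSum F e (fun τ => if t < τ then (1 : ℤ) else 0))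
    (S := fun t => f.leftSlope e t - edgeSum F e (fun τ => if t ≤ τ then (1 : ℤ) else 0))
    (fun t ht => by
      filter_upwards [f.right_affine e t ht, eventually_edgeSum_min_right F e t] with s h1 h2
      rw [h1, h2]
      push_cast
      ring)
    (fun t ht => by
      filter_upwards [f.left_affine e t ht, eventually_edgeSum_min_left F e t] with s h1 h2
      rw [h1, h2]
      push_cast
      ring)
    (fun t ht => by
      have h1 := edgeSum_lt_sub_edgeSum_le F e ht
      have h2 : F (Sum.inr ⟨e, ⟨t, ht⟩⟩) = f.rightSlope e t + f.leftSlope e t := hF _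
      linarith)
  have e1 : edgeSum F e (fun τ => if 0 < τ then (1 : ℤ) else 0) =
      edgeSum F e (fun _ => (1 : ℤ)) := edgeSum_congr F e fun t ht => by simp [ht.1]
  have e2 : edgeSum F e (fun τ => if Γ.len e ≤ τ then (1 : ℤ) else 0) = 0 :=
    (edgeSum_congr F e fun t ht => by simp [ht.2]).trans (edgeSum_const_zero F e)
  have e3 : edgeSum F e (fun τ => min 0 τ) = 0 :=
    (edgeSum_congr F e fun t ht => by simp [ht.1.le]).trans (edgeSum_const_zero F e)
  have e4 : edgeSum F e (fun τ => min (Γ.len e) τ) = edgeSum F e fun t => t :=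
    edgeSum_congr F e fun t ht => by simp [ht.2.le]
  simp only [e1, e2, e3, e4, edgePoint_zero, edgePoint_len] at h
  obtain ⟨h1, h2⟩ := h
  refine ⟨by linarith, ?_⟩
  have h3 : f.rightSlope e 0 + edgeSum F e (fun _ => (1 : ℤ)) = -f.leftSlope e (Γ.len e) := by
    linarith
  rw [h3] at h2
  push_cast at h2
  linarith

/-- The integral chain is given by the outgoing slopes of `f` at the targets. Its integral,
corrected by the root segments of `F`, is minus the coboundary of the vertex values of `f`, which
pairs to zero with cycles. -/
lemma isAbelJacobiLift_zero_of_ord (v₀ : Γ.V) (f : Γ.RationalFunction) {F : Γ.Divisor}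
    (hF : ∀ x, F x = f.ord x) : degree F = 0 ∧ IsAbelJacobiLift v₀ F 0 := by
  have hb : Γ.boundary ℤ (fun e => f.leftSlope e (Γ.len e)) = rootDegree F := by
    funext v
    rw [rootDegree_eq, hF]
    simp only [boundary, LinearMap.coe_mk, AddHom.coe_mk, RationalFunction.ord]
    rw [← Finset.sum_add_distrib]
    refine Finset.sum_congr rfl fun e _ => ?_
    have := (f.slope_relation hF e).1
    split_ifs <;> linarith
  have hdeg : degree F = 0 := by rw [← sum_rootDegree, ← hb, sum_boundary]
  refine ⟨hdeg, isAbelJacobiLift_iff.2 ⟨_, by rw [hb, hdeg]; simp, ?_⟩⟩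
  ext ω
  rw [add_apply, divisorDual_apply, chainDual, sum_apply, ← Finset.sum_add_distrib, zero_apply]
  have h1 := sum_mul_sub_eq (fun v => f.toFun (Sum.inl v)) (ω : Γ.E → ℝ)
  have h2 : Γ.boundary ℝ (ω : Γ.E → ℝ) = 0 := ω.2
  rw [h2] at h1
  simp only [Pi.zero_apply, mul_zero, Finset.sum_const_zero] at h1
  rw [← neg_eq_zero, ← Finset.sum_neg_distrib] at h1
  rw [← h1]
  refine Finset.sum_congr rfl fun e _ => ?_
  rw [(f.slope_relation hF e).2]
  simp
  ring

lemma LinearlyEquivalent.degree_eq {D D' : Γ.Divisor} (h : LinearlyEquivalent D D') :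
    degree D' = degree D := by
  obtain ⟨f, hf⟩ := h
  have := (isAbelJacobiLift_zero_of_ord (Classical.arbitrary Γ.V) f (F := D' - D)
    (fun x => by rw [Finsupp.sub_apply, hf]; ring)).1
  rw [degree_sub] at this
  linarith

lemma LinearlyEquivalent.isAbelJacobiLift {D D' : Γ.Divisor} (h : LinearlyEquivalent D D')
    {v₀ : Γ.V} {ξ : Γ.JacCover} (hξ : IsAbelJacobiLift v₀ D ξ) : IsAbelJacobiLift v₀ D' ξ := by
  obtain ⟨f, hf⟩ := h
  have := (isAbelJacobiLift_zero_of_ord v₀ f (F := D' - D)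
    (fun x => by rw [Finsupp.sub_apply, hf]; ring)).2
  simpa using hξ.add this

/-- A functional on chains that kills the kernel of the boundary map factors through that map. -/
lemma exists_potential (b : Γ.E → ℝ) (hb : ∀ ω : Γ.H1, ∑ e, b e * (ω : Γ.E → ℝ) e = 0) :
    ∃ h : Γ.V → ℝ, ∀ e, h (Γ.tgt e) - h (Γ.src e) = b e := by
  let φ : Module.Dual ℝ (Γ.E → ℝ) := ∑ e, b e • LinearMap.proj e
  have hφ : φ ∈ LinearMap.range (Γ.boundary ℝ).dualMap := by
    rw [LinearMap.range_dualMap_eq_dualAnnihilator_ker, Submodule.mem_dualAnnihilator]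
    intro ω hω
    simpa [φ] using hb ⟨ω, hω⟩
  obtain ⟨ψ, hψ⟩ := hφ
  refine ⟨fun v => ψ (Pi.single v 1), fun e => ?_⟩
  have h1 := LinearMap.congr_fun hψ (Pi.single e 1)
  rw [LinearMap.dualMap_apply, boundary_single ℝ, map_sub] at h1
  rw [h1]
  simp only [φ, LinearMap.sum_apply, LinearMap.smul_apply, LinearMap.proj_apply, smul_eq_mul]
  rw [Finset.sum_eq_single e] <;> simp +contextual

/-- Reverses the slope relation: the vertex values come from a potential, and the chain `c`
prescribes the outgoing slopes at the targets. -/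
lemma exists_ord_eq {v₀ : Γ.V} {F : Γ.Divisor} (hdeg : degree F = 0)
    (hF : IsAbelJacobiLift v₀ F 0) : ∃ f : Γ.RationalFunction, ∀ x, f.ord x = F x := by
  obtain ⟨c, hc, h0⟩ := isAbelJacobiLift_iff.1 hF
  rw [hdeg, Pi.single_zero, sub_zero] at hc
  obtain ⟨h, hh⟩ := exists_potential (Γ := Γ) (fun e => -(c e * Γ.len e + edgeSum F e fun t => t))
    (fun ω => by
      have := congrArg (fun ξ : Γ.JacCover => ξ ω) h0
      simp only [zero_apply, add_apply, divisorDual_apply, chainDual, sum_apply,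
        ← Finset.sum_add_distrib] at this
      rw [← neg_eq_zero, ← Finset.sum_neg_distrib, this]
      refine Finset.sum_congr rfl fun e _ => ?_
      simp
      ring)
  let g : Γ.E → ℝ → ℝ := fun e s =>
    h (Γ.src e) - c e * s - edgeSum F e (fun τ => min s τ)
  let val : Γ.Point → ℝ := fun x => match x with
    | Sum.inl v => h v
    | Sum.inr ⟨e, t⟩ => g e t
  have hval : ∀ e, ∀ s ∈ Set.Icc (0 : ℝ) (Γ.len e), val (Γ.edgePoint e s) = g e s := by
    intro e s hs
    rcases hs.1.eq_or_lt with rfl | hs0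
    · have e3 : edgeSum F e (fun τ => min 0 τ) = 0 :=
        (edgeSum_congr F e fun t ht => by simp [ht.1.le]).trans (edgeSum_const_zero F e)
      rw [edgePoint_zero]
      simp [val, g, e3]
    rcases hs.2.eq_or_lt with rfl | hs1
    · have e4 : edgeSum F e (fun τ => min (Γ.len e) τ) = edgeSum F e fun t => t :=
        edgeSum_congr F e fun t ht => by simp [ht.2.le]
      rw [edgePoint_len]
      simp only [val, g, e4]
      linarith [hh e]
    · rw [edgePoint_of_mem ⟨hs0, hs1⟩]
  refine ⟨{ toFun := val
            rightSlope := fun e t =>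
              -(c e + edgeSum F e (fun τ => if t < τ then (1 : ℤ) else 0))
            leftSlope := fun e t => c e + edgeSum F e (fun τ => if t ≤ τ then (1 : ℤ) else 0)
            right_affine := ?_
            left_affine := ?_ }, ?_⟩
  · intro e t ht
    filter_upwards [eventually_edgeSum_min_right F e t, Ioo_mem_nhdsGT ht.2] with s h1 hs
    rw [hval e s ⟨ht.1.trans hs.1.le, hs.2.le⟩, hval e t ⟨ht.1, ht.2.le⟩]
    simp only [g]
    rw [h1]
    push_cast
    ring
  · intro e t ht
    filter_upwards [eventually_edgeSum_min_left F e t, Ioo_mem_nhdsLT ht.1] with s h1 hs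
    rw [hval e s ⟨hs.1.le, hs.2.le.trans ht.2⟩, hval e t ⟨ht.1.le, ht.2⟩]
    simp only [g]
    rw [h1]
    push_cast
    ring
  · rintro (v | ⟨e, t, ht⟩)
    · have h1 := rootDegree_eq F v
      rw [← hc] at h1
      simp only [boundary, LinearMap.coe_mk, AddHom.coe_mk] at h1
      rw [← sub_eq_iff_eq_add, ← Finset.sum_sub_distrib] at h1
      rw [← h1]
      simp only [RationalFunction.ord]
      refine Finset.sum_congr rfl fun e _ => ?_
      have e1 : edgeSum F e (fun τ => if 0 < τ then (1 : ℤ) else 0) =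
          edgeSum F e (fun _ => (1 : ℤ)) := edgeSum_congr F e fun t ht => by simp [ht.1]
      have e2 : edgeSum F e (fun τ => if Γ.len e ≤ τ then (1 : ℤ) else 0) = 0 :=
        (edgeSum_congr F e fun t ht => by simp [ht.2]).trans (edgeSum_const_zero F e)
      rw [e1, e2]
      split_ifs <;> ring
    · simp only [RationalFunction.ord]
      linarith [edgeSum_lt_sub_edgeSum_le F e ht]

/-- Divisors of the same degree with the same image in the Jacobian are equivalent. -/
lemma linearlyEquivalent_of_isAbelJacobiLift {v₀ : Γ.V} {D D' : Γ.Divisor} {ξ : Γ.JacCover}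
    (hdeg : degree D = degree D') (h : IsAbelJacobiLift v₀ D ξ)
    (h' : IsAbelJacobiLift v₀ D' ξ) : LinearlyEquivalent D D' := by
  have h0 := h'.sub h
  have : ξ - ξ = 0 := by ext; simp
  rw [this] at h0
  obtain ⟨f, hf⟩ := exists_ord_eq (by rw [degree_sub, hdeg, sub_self]) h0
  exact ⟨f, fun x => by rw [hf, Finsupp.sub_apply]; ring⟩

end MetricGraph

end

noncomputable section

/-! ### Linear algebra and dimension -/

/-- Greedy choice: while the sum is proper, some member of the spanning family lies outside it and
raises the dimension. -/
lemma exists_tuple_finrank_sup_span_ge {V ι : Type*} [AddCommGroup V] [Module ℝ V]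
    [FiniteDimensional ℝ V] [Nonempty ι] {w : ι → V} (hw : Submodule.span ℝ (Set.range w) = ⊤)
    (L : Submodule ℝ V) (k : ℕ) :
    ∃ τ : Fin k → ι, min (Module.finrank ℝ V) (Module.finrank ℝ L + k) ≤
      Module.finrank ℝ (L ⊔ Submodule.span ℝ (Set.range (w ∘ τ)) : Submodule ℝ V) := by
  induction k with
  | zero =>
    exact ⟨Fin.elim0, (min_le_right _ _).trans (Submodule.finrank_mono le_sup_left)⟩
  | succ k ih =>
    obtain ⟨τ, hτ⟩ := ih
    set W := L ⊔ Submodule.span ℝ (Set.range (w ∘ τ)) with hW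
    have key : ∀ e, W ⊔ Submodule.span ℝ {w e} ≤
        L ⊔ Submodule.span ℝ (Set.range (w ∘ (Fin.cons e τ : Fin (k + 1) → ι))) := by
      intro e
      refine sup_le (sup_le_sup_left (Submodule.span_mono ?_) _)
        (le_sup_of_le_right (Submodule.span_mono ?_))
      · rintro _ ⟨i, rfl⟩
        exact ⟨i.succ, by simp⟩
      · rintro _ rfl
        exact ⟨0, by simp⟩
    by_cases hT : W = ⊤
    · refine ⟨Fin.cons (Classical.arbitrary ι) τ, ?_⟩
      have h1 := key (Classical.arbitrary ι)
      rw [hT, top_sup_eq] at h1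
      rw [top_le_iff.1 h1, finrank_top]
      exact min_le_left _ _
    · obtain ⟨e, he⟩ : ∃ e, w e ∉ W := by
        by_contra! hcon
        refine hT (top_le_iff.1 ?_)
        rw [← hw, Submodule.span_le]
        rintro _ ⟨e, rfl⟩
        exact hcon e
      refine ⟨Fin.cons e τ, ?_⟩
      have h1 : W < W ⊔ Submodule.span ℝ {w e} := by
        refine lt_of_le_of_ne le_sup_left fun h => he ?_
        rw [h]
        exact Submodule.mem_sup_right (Submodule.mem_span_singleton_self _)
      have h2 := Submodule.finrank_lt_finrank_of_lt h1
      have h3 := Submodule.finrank_mono (key e)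
      omega

lemma exists_span_le_of_box_subset {V I : Type*} [AddCommGroup V] [Module ℝ V] [Countable I]
    {r : ℕ} (w : Fin r → V) {ℓ : Fin r → ℝ} (hℓ : ∀ j, 0 < ℓ j) (W : I → Submodule ℝ V)
    (a : I → V)
    (h : ∀ t : Fin r → ℝ, (∀ j, t j ∈ Set.Ioo 0 (ℓ j)) → ∃ i, a i - ∑ j, t j • w j ∈ W i) :
    ∃ i, Submodule.span ℝ (Set.range w) ≤ W i ∧ a i ∈ W i := by
  let T : (Fin r → ℝ) →ₗ[ℝ] V := Fintype.linearCombination ℝ w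
  have hT : ∀ t, T t = ∑ j, t j • w j := fun t => Fintype.linearCombination_apply _ _ _
  let A : I → Set (Fin r → ℝ) := fun i => {t | a i - T t ∈ W i}
  let B : Set (Fin r → ℝ) := Set.univ.pi fun j => Set.Ioo 0 (ℓ j)
  have hB : 0 < MeasureTheory.volume B := by
    refine IsOpen.measure_pos _ (isOpen_set_pi Set.finite_univ fun _ _ => isOpen_Ioo) ?_
    exact ⟨fun j => ℓ j / 2, fun j _ => ⟨half_pos (hℓ j), half_lt_self (hℓ j)⟩⟩
  have hBA : B ⊆ ⋃ i, A i := fun t ht => by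
    obtain ⟨i, hi⟩ := h t fun j => ht j (Set.mem_univ j)
    exact Set.mem_iUnion.2 ⟨i, by simpa only [A, Set.mem_ofPred_eq, hT] using hi⟩
  obtain ⟨i, hi⟩ : ∃ i, MeasureTheory.volume (A i) ≠ 0 := by
    by_contra! hcon
    exact hB.ne' (MeasureTheory.measure_mono_null hBA (MeasureTheory.measure_iUnion_null hcon))
  obtain ⟨t₀, ht₀⟩ : (A i).Nonempty := by
    by_contra hcon
    rw [Set.not_nonempty_iff_eq_empty] at hcon
    simp [hcon] at hi
  have hsub : A i ⊆ (AffineSubspace.mk' t₀ ((W i).comap T) : Set (Fin r → ℝ)) := fun t ht => by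
    rw [SetLike.mem_coe, AffineSubspace.mem_mk', vsub_eq_sub, Submodule.mem_comap, map_sub]
    have := (W i).sub_mem ht₀ ht
    simpa using this
  -- A proper affine subspace is a null set, so the one containing `A i` is everything.
  have htop : AffineSubspace.mk' t₀ ((W i).comap T) = ⊤ := by
    by_contra hcon
    exact hi (MeasureTheory.measure_mono_null hsub
      (MeasureTheory.Measure.addHaar_affineSubspace _ _ hcon))
  have hcomap : (W i).comap T = ⊤ := by
    rw [← AffineSubspace.direction_mk' t₀ ((W i).comap T), htop, AffineSubspace.direction_top]
  have hmem : ∀ t, T t ∈ W i := fun t => by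
    have : t ∈ (W i).comap T := hcomap ▸ Submodule.mem_top
    exact this
  refine ⟨i, ?_, ?_⟩
  · rw [Submodule.span_le]
    rintro _ ⟨j, rfl⟩
    have := hmem (Pi.single j 1)
    rwa [Fintype.linearCombination_apply_single, one_smul] at this
  · have := (W i).add_mem (hmem t₀) ht₀
    simpa using this

lemma dimH_le_of_forall_tuple {V ι I : Type*} [NormedAddCommGroup V] [NormedSpace ℝ V]
    [FiniteDimensional ℝ V] [Finite ι] [Nonempty ι] [Countable I] {w : ι → V}
    (hw : Submodule.span ℝ (Set.range w) = ⊤) {r m : ℕ} (hm : m < Module.finrank ℝ V)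
    (W : I → Submodule ℝ V) (hW : ∀ i, Module.finrank ℝ (W i) ≤ m) (a : (Fin r → ι) → I → V)
    {X : Set V} (hX : ∀ ξ ∈ X, ∀ τ : Fin r → ι,
      ∃ i, Submodule.span ℝ (Set.range (w ∘ τ)) ≤ W i ∧ ξ - a τ i ∈ W i) :
    dimH X ≤ ((m - r : ℕ) : ℝ≥0∞) := by
  let Y : ((Fin r → ι) → I) → Set V := fun σ => {ξ | ∀ τ,
    Submodule.span ℝ (Set.range (w ∘ τ)) ≤ W (σ τ) ∧ ξ - a τ (σ τ) ∈ W (σ τ)}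
  have hXY : X ⊆ ⋃ σ, Y σ := fun ξ hξ => by
    choose σ hσ using hX ξ hξ
    exact Set.mem_iUnion.2 ⟨σ, hσ⟩
  refine (dimH_mono hXY).trans ?_
  rw [dimH_iUnion]
  refine iSup_le fun σ => ?_
  rcases (Y σ).eq_empty_or_nonempty with hemp | ⟨ξ₀, hξ₀⟩
  · simp [hemp]
  let L : Submodule ℝ V := ⨅ τ, W (σ τ)
  have hsub : Y σ ⊆ Set.range fun x : L => ξ₀ + (x : V) := by
    intro ξ hξ
    refine ⟨⟨ξ - ξ₀, ?_⟩, by simp⟩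
    rw [Submodule.mem_iInf]
    intro τ
    have := (W (σ τ)).sub_mem (hξ τ).2 (hξ₀ τ).2
    simpa using this
  have hiso : Isometry fun x : L => ξ₀ + (x : V) :=
    (isometry_add_left ξ₀).comp isometry_subtype_coe
  -- As `m < finrank V`, the minimum in `hτ` can only be `finrank L + r`.
  have hL : Module.finrank ℝ L ≤ m - r := by
    obtain ⟨τ, hτ⟩ := exists_tuple_finrank_sup_span_ge hw L r
    have h1 : L ⊔ Submodule.span ℝ (Set.range (w ∘ τ)) ≤ W (σ τ) :=
      sup_le (iInf_le _ τ) (hξ₀ τ).1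
    have h2 := Submodule.finrank_mono h1
    have h3 := hW (σ τ)
    omega
  calc dimH (Y σ) ≤ dimH (Set.range fun x : L => ξ₀ + (x : V)) := dimH_mono hsub
    _ ≤ dimH (Set.univ : Set L) := hiso.lipschitz.dimH_range_le
    _ = (Module.finrank ℝ L : ℝ≥0∞) := Real.dimH_univ_eq_finrank L
    _ ≤ _ := by exact_mod_cast hL

lemma le_dimH_of_box_subset {V : Type*} [NormedAddCommGroup V] [NormedSpace ℝ V]
    [FiniteDimensional ℝ V] {n : ℕ} {w : Fin n → V} (hw : LinearIndependent ℝ w)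
    {ℓ : Fin n → ℝ} (hℓ : ∀ j, 0 < ℓ j) (a : V) {X : Set V}
    (h : ∀ t : Fin n → ℝ, (∀ j, t j ∈ Set.Ioo 0 (ℓ j)) → a + ∑ j, t j • w j ∈ X) :
    (n : ℝ≥0∞) ≤ dimH X := by
  let T : (Fin n → ℝ) →ₗ[ℝ] V := Fintype.linearCombination ℝ w
  have hT : ∀ t, T t = ∑ j, t j • w j := fun t => Fintype.linearCombination_apply _ _ _
  have hker : LinearMap.ker T = ⊥ := by
    rw [LinearMap.ker_eq_bot]
    exact linearIndependent_iff_injective_fintypeLinearCombination.1 hw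
  obtain ⟨K, _, hK⟩ := T.exists_antilipschitzWith hker
  have hK' : AntilipschitzWith K fun t => a + T t := fun s t => by
    rw [edist_add_left]
    exact hK s t
  let B : Set (Fin n → ℝ) := Set.univ.pi fun j => Set.Ioo 0 (ℓ j)
  have hB : dimH B = n := by
    rw [Real.dimH_of_nonempty_interior]
    · simp
    · rw [(isOpen_set_pi Set.finite_univ fun _ _ => isOpen_Ioo).interior_eq]
      exact ⟨fun j => ℓ j / 2, fun j _ => ⟨half_pos (hℓ j), half_lt_self (hℓ j)⟩⟩
  rw [← hB]
  refine (hK'.le_dimH_image B).trans (dimH_mono ?_)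
  rintro _ ⟨t, ht, rfl⟩
  simp only [hT]
  exact h t fun j => ht j (Set.mem_univ j)

namespace MetricGraph

variable {Γ : MetricGraph.{u}}

/-! ### Effective divisors -/

lemma card_support_le_degree {D : Γ.Divisor} (hD : 0 ≤ D) : (D.support.card : ℤ) ≤ degree D := by
  rw [degree, Finsupp.sum, Finset.cast_card]
  refine Finset.sum_le_sum fun x hx => ?_
  have h1 : 0 ≤ D x := hD x
  have h2 : D x ≠ 0 := Finsupp.mem_support_iff.1 hx
  omega

lemma eq_zero_of_degree_eq_zero {D : Γ.Divisor} (hD : 0 ≤ D) (h : degree D = 0) : D = 0 := by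
  have := card_support_le_degree hD
  rw [h] at this
  rw [← Finsupp.support_eq_empty, ← Finset.card_eq_zero]
  omega

lemma exists_eq_add_single {D : Γ.Divisor} (hD : 0 ≤ D) {n : ℕ} (h : degree D = (n + 1 : ℕ)) :
    ∃ (D' : Γ.Divisor) (x : Γ.Point), 0 ≤ D' ∧ degree D' = n ∧ D = D' + Finsupp.single x 1 := by
  obtain ⟨x, hx⟩ : ∃ x, D x ≠ 0 := by
    by_contra! hcon
    have : D = 0 := Finsupp.ext hcon
    rw [this, degree_zero] at h
    omega
  refine ⟨D - Finsupp.single x 1, x, fun y => ?_, ?_, by abel⟩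
  · have h1 : 0 ≤ D y := hD y
    rw [Finsupp.sub_apply, Finsupp.single_apply]
    split_ifs with hxy
    · subst hxy
      simp only [Finsupp.coe_zero, Pi.zero_apply]
      omega
    · simpa using h1
  · rw [degree_sub, h, degree_single]
    push_cast
    ring

lemma eq_single_of_degree_eq_one {D : Γ.Divisor} (hD : 0 ≤ D) (h : degree D = 1) :
    ∃ x, D = Finsupp.single x 1 := by
  obtain ⟨D', x, h1, h2, h3⟩ := exists_eq_add_single (n := 0) hD (by simpa using h)
  rw [eq_zero_of_degree_eq_zero h1 (by simpa using h2), zero_add] at h3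
  exact ⟨x, h3⟩

lemma single_nonneg (x : Γ.Point) : (0 : Γ.Divisor) ≤ Finsupp.single x 1 := fun y => by
  rw [Finsupp.single_apply]
  split_ifs <;> simp

lemma sum_edgePoint_nonneg {n : ℕ} (e : Fin n → Γ.E) (t : Fin n → ℝ) :
    (0 : Γ.Divisor) ≤ ∑ j, Finsupp.single (Γ.edgePoint (e j) (t j)) 1 :=
  Finset.sum_nonneg fun _ _ => single_nonneg _

lemma degree_sum_edgePoint {n : ℕ} (e : Fin n → Γ.E) (t : Fin n → ℝ) :
    degree (∑ j, Finsupp.single (Γ.edgePoint (e j) (t j)) 1 : Γ.Divisor) = n := by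
  rw [degree_sum]
  simp

lemma exists_isAbelJacobiLift_sum_edgePoint (v₀ : Γ.V) {n : ℕ} (e : Fin n → Γ.E) :
    ∃ κ : Γ.JacCover, ∀ t : Fin n → ℝ, (∀ j, t j ∈ Set.Ioo 0 (Γ.len (e j))) →
      IsAbelJacobiLift v₀ (∑ j, Finsupp.single (Γ.edgePoint (e j) (t j)) 1)
        (κ + ∑ j, t j • edgeDual (e j)) := by
  choose κ hκ using fun v => exists_isAbelJacobiLift_single v₀ (Sum.inl v : Γ.Point)
  refine ⟨∑ j, κ (Γ.src (e j)), fun t ht => ?_⟩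
  rw [← Finset.sum_add_distrib]
  exact IsAbelJacobiLift.sum _ fun j _ => (hκ (Γ.src (e j))).edgePoint ⟨(ht j).1.le, (ht j).2.le⟩

/-- Each point in the support contributes a multiple of the `edgeDual` of its own edge, and vertices
contribute nothing. -/
lemma IsAbelJacobiLift.exists_sub_mem_span {v₀ : Γ.V} {D : Γ.Divisor} {ξ : Γ.JacCover}
    (h : IsAbelJacobiLift v₀ D ξ) (hD : 0 ≤ D) {n : ℕ} (hdeg : degree D = n) :
    ∃ (c : Γ.E → ℤ) (S : Finset Γ.E), S.card ≤ n ∧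
      ξ - chainDual c ∈ Submodule.span ℝ (edgeDual '' (S : Set Γ.E)) := by
  obtain ⟨c, -, rfl⟩ := isAbelJacobiLift_iff.1 h
  let edges : Γ.Point → Finset Γ.E := Sum.elim (fun _ => ∅) fun p => {p.1}
  refine ⟨c, D.support.biUnion edges, ?_, ?_⟩
  · have h1 : (D.support.biUnion edges).card ≤ D.support.card * 1 := by
      refine Finset.card_biUnion_le_card_mul _ _ _ fun x _ => ?_
      rcases x with v | p <;> simp [edges]
    have h2 := card_support_le_degree hD
    omega
  · rw [add_sub_cancel_left (chainDual c), divisorDual, Finsupp.sum]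
    refine Submodule.sum_mem _ fun x hx => Submodule.smul_mem _ _ ?_
    rcases x with v | ⟨e, t⟩
    · exact Submodule.zero_mem _
    · refine Submodule.smul_mem _ _ (Submodule.subset_span ⟨e, ?_, rfl⟩)
      rw [Finset.mem_coe, Finset.mem_biUnion]
      exact ⟨_, hx, by simp [edges]⟩

/-! ### Dimension bounds for Brill–Noether loci -/


lemma nonempty_edge (h : 0 < Γ.genus) : Nonempty Γ.E := by
  by_contra hcon
  rw [not_nonempty_iff] at hcon
  rw [← finrank_jacCover, ← finrank_top, ← span_range_edgeDual, Set.range_eq_empty,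
    Submodule.span_empty, finrank_bot] at h
  exact h.false

lemma exists_span_le_of_mem_brillNoetherLift {v₀ : Γ.V} {r d : ℕ} (hrd : r ≤ d)
    {ξ : Γ.JacCover} (hξ : ξ ∈ Γ.brillNoetherLift v₀ r d) {τ : Fin r → Γ.E} {κ : Γ.JacCover}
    (hκ : ∀ t : Fin r → ℝ, (∀ j, t j ∈ Set.Ioo 0 (Γ.len (τ j))) →
      IsAbelJacobiLift v₀ (∑ j, Finsupp.single (Γ.edgePoint (τ j) (t j)) 1)
        (κ + ∑ j, t j • edgeDual (τ j))) :
    ∃ i : (Γ.E → ℤ) × {S : Finset Γ.E // S.card ≤ d - r},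
      Submodule.span ℝ (Set.range (edgeDual ∘ τ)) ≤
        Submodule.span ℝ (edgeDual '' (i.2.1 : Set Γ.E)) ∧
      ξ - (κ + chainDual i.1) ∈ Submodule.span ℝ (edgeDual '' (i.2.1 : Set Γ.E)) := by
  obtain ⟨D, hdeg, hrank, hξ⟩ := hξ
  have key : ∀ t : Fin r → ℝ, (∀ j, t j ∈ Set.Ioo 0 (Γ.len (τ j))) →
      ∃ i : (Γ.E → ℤ) × {S : Finset Γ.E // S.card ≤ d - r},
        ξ - (κ + chainDual i.1) - ∑ j, t j • (edgeDual ∘ τ) j ∈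
          Submodule.span ℝ (edgeDual '' (i.2.1 : Set Γ.E)) := by
    intro t ht
    obtain ⟨D', hD', hequiv⟩ := hrank _ (sum_edgePoint_nonneg τ t) (degree_sum_edgePoint τ t)
    have hdeg' : degree D' = (d - r : ℕ) := by
      rw [hequiv.degree_eq, degree_sub, hdeg, degree_sum_edgePoint]
      omega
    obtain ⟨c, S, hS, hmem⟩ := (hequiv.isAbelJacobiLift
      (hξ.sub (hκ t ht))).exists_sub_mem_span hD' hdeg'
    refine ⟨(c, ⟨S, hS⟩), ?_⟩
    convert hmem using 1
    simp only [Function.comp]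
    abel
  exact exists_span_le_of_box_subset (V := Γ.JacCover) (ℓ := fun j => Γ.len (τ j))
    (edgeDual ∘ τ) (fun j => Γ.len_pos _)
    (fun i : (Γ.E → ℤ) × {S : Finset Γ.E // S.card ≤ d - r} =>
      Submodule.span ℝ (edgeDual '' (i.2.1 : Set Γ.E)))
    (fun i => ξ - (κ + chainDual i.1)) key

lemma dimH_brillNoetherLift_le (v₀ : Γ.V) {r d : ℕ} (hrd : r ≤ d) (hd : d - r < Γ.genus) :
    dimH (Γ.brillNoetherLift v₀ r d) ≤ ((d - r - r : ℕ) : ℝ≥0∞) := by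
  have hne : Nonempty Γ.E := nonempty_edge (by omega)
  choose κ hκ using fun τ : Fin r → Γ.E => exists_isAbelJacobiLift_sum_edgePoint v₀ τ
  have hW : ∀ i : (Γ.E → ℤ) × {S : Finset Γ.E // S.card ≤ d - r},
      Module.finrank ℝ (Submodule.span ℝ (edgeDual '' (i.2.1 : Set Γ.E))) ≤ d - r := by
    classical
    intro i
    rw [← Finset.coe_image]
    exact (finrank_span_finset_le_card _).trans (Finset.card_image_le.trans i.2.2)
  have hm : d - r < Module.finrank ℝ Γ.JacCover := by rwa [finrank_jacCover]
  have key := dimH_le_of_forall_tuple (V := Γ.JacCover) (ι := Γ.E)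
    (I := (Γ.E → ℤ) × {S : Finset Γ.E // S.card ≤ d - r}) (w := edgeDual) (r := r)
    (m := d - r) (X := Γ.brillNoetherLift v₀ r d)
  exact key span_range_edgeDual hm
    (fun i : (Γ.E → ℤ) × {S : Finset Γ.E // S.card ≤ d - r} =>
      Submodule.span ℝ (edgeDual '' (i.2.1 : Set Γ.E))) hW
    (fun τ i => κ τ + chainDual i.1)
    fun ξ hξ τ => exists_span_le_of_mem_brillNoetherLift hrd hξ (hκ τ)

lemma le_dimH_brillNoetherLift (v₀ : Γ.V) {r d n : ℕ} {e : Fin n → Γ.E}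
    (he : LinearIndependent ℝ (edgeDual ∘ e)) {D : Γ.Divisor} (hD : degree D + n = d)
    (hrank : ∀ t : Fin n → ℝ, (∀ j, t j ∈ Set.Ioo 0 (Γ.len (e j))) →
      RankAtLeast (D + ∑ j, Finsupp.single (Γ.edgePoint (e j) (t j)) 1) r) :
    (Γ.brillNoetherLift v₀ r d).Nonempty ∧
      (n : ℝ≥0∞) ≤ dimH (Γ.brillNoetherLift v₀ r d) := by
  obtain ⟨ξ, hξ⟩ := exists_isAbelJacobiLift v₀ D
  obtain ⟨κ, hκ⟩ := exists_isAbelJacobiLift_sum_edgePoint v₀ e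
  have key : ∀ t : Fin n → ℝ, (∀ j, t j ∈ Set.Ioo 0 (Γ.len (e j))) →
      (ξ + κ) + ∑ j, t j • (edgeDual ∘ e) j ∈ Γ.brillNoetherLift v₀ r d := fun t ht => by
    refine ⟨_, ?_, hrank t ht, ?_⟩
    · rw [degree_add, degree_sum_edgePoint, hD]
    · rw [add_assoc ξ κ]
      exact hξ.add (hκ t ht)
  refine ⟨⟨_, key (fun j => Γ.len (e j) / 2) fun j =>
    ⟨half_pos (Γ.len_pos _), half_lt_self (Γ.len_pos _)⟩⟩, ?_⟩
  have hdim := le_dimH_of_box_subset (V := Γ.JacCover) (w := edgeDual ∘ e)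
    (ℓ := fun j => Γ.len (e j)) (X := Γ.brillNoetherLift v₀ r d)
  exact hdim he (fun j => Γ.len_pos (e j)) (ξ + κ) key

lemma brillNoetherDim_le (v₀ : Γ.V) {r d : ℕ} (hrd : 2 * r ≤ d) (hd : d < Γ.genus) :
    Γ.brillNoetherDim v₀ r d ≤ (((d - 2 * r : ℕ) : ℝ≥0∞) : WithBot ℝ≥0∞) := by
  rw [brillNoetherDim]
  split_ifs
  · rw [WithBot.coe_le_coe, two_mul, ← Nat.sub_sub]
    exact dimH_brillNoetherLift_le v₀ (by omega) (by omega)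
  · exact bot_le

lemma brillNoetherDim_eq (v₀ : Γ.V) {r d : ℕ} (hrd : 2 * r ≤ d) (hd : d < Γ.genus)
    {e : Fin (d - 2 * r) → Γ.E} (he : LinearIndependent ℝ (edgeDual ∘ e)) {D : Γ.Divisor}
    (hD : degree D = 2 * r)
    (hrank : ∀ t : Fin (d - 2 * r) → ℝ, (∀ j, t j ∈ Set.Ioo 0 (Γ.len (e j))) →
      RankAtLeast (D + ∑ j, Finsupp.single (Γ.edgePoint (e j) (t j)) 1) r) :
    Γ.brillNoetherDim v₀ r d = (((d - 2 * r : ℕ) : ℝ≥0∞) : WithBot ℝ≥0∞) := by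
  refine (brillNoetherDim_le v₀ hrd hd).antisymm ?_
  obtain ⟨h1, h2⟩ := le_dimH_brillNoetherLift v₀ he (d := d) (by rw [hD]; omega) hrank
  rw [brillNoetherDim, if_pos h1, WithBot.coe_le_coe]
  exact h2

/-! ### Rank of sums -/

lemma LinearlyEquivalent.refl (D : Γ.Divisor) : LinearlyEquivalent D D := by
  obtain ⟨ξ, h⟩ := exists_isAbelJacobiLift (Classical.arbitrary Γ.V) D
  exact linearlyEquivalent_of_isAbelJacobiLift rfl h h

/-- Read off in the Jacobian, where lifts add. -/
lemma LinearlyEquivalent.add {D₁ D₁' D₂ D₂' : Γ.Divisor} (h₁ : LinearlyEquivalent D₁ D₁')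
    (h₂ : LinearlyEquivalent D₂ D₂') : LinearlyEquivalent (D₁ + D₂) (D₁' + D₂') := by
  obtain ⟨ξ₁, hξ₁⟩ := exists_isAbelJacobiLift (Classical.arbitrary Γ.V) D₁
  obtain ⟨ξ₂, hξ₂⟩ := exists_isAbelJacobiLift (Classical.arbitrary Γ.V) D₂
  refine linearlyEquivalent_of_isAbelJacobiLift ?_ (hξ₁.add hξ₂)
    ((h₁.isAbelJacobiLift hξ₁).add (h₂.isAbelJacobiLift hξ₂))
  rw [degree_add, degree_add, h₁.degree_eq, h₂.degree_eq]

lemma rankAtLeast_zero {D : Γ.Divisor} (hD : 0 ≤ D) : RankAtLeast D 0 := fun E hE hdeg => by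
  rw [eq_zero_of_degree_eq_zero hE (by simpa using hdeg), sub_zero]
  exact ⟨D, hD, LinearlyEquivalent.refl D⟩

/-- Split one point off `E`: `D'` absorbs it and `D` absorbs the rest. -/
lemma RankAtLeast.add_one {D D' : Γ.Divisor} {r : ℕ} (h : RankAtLeast D r)
    (h' : RankAtLeast D' 1) : RankAtLeast (D + D') (r + 1) := fun E hE hdeg => by
  obtain ⟨F, x, hF, hFdeg, rfl⟩ := exists_eq_add_single hE hdeg
  obtain ⟨D₁, hD₁, h₁⟩ := h F hF hFdeg
  obtain ⟨D₂, hD₂, h₂⟩ := h' _ (single_nonneg x) (by simp)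
  refine ⟨D₁ + D₂, add_nonneg hD₁ hD₂, ?_⟩
  rw [add_sub_add_comm]
  exact h₁.add h₂

lemma RankAtLeast.nsmul_add {D F : Γ.Divisor} (h : RankAtLeast D 1) (hF : 0 ≤ F) (r : ℕ) :
    RankAtLeast (r • D + F) r := by
  induction r with
  | zero => simpa using rankAtLeast_zero hF
  | succ r ih =>
    rw [succ_nsmul, add_right_comm]
    exact ih.add_one h

lemma degree_nsmul (n : ℕ) (D : Γ.Divisor) : degree (n • D) = n * degree D := by
  induction n with
  | zero => simp
  | succ n ih => rw [succ_nsmul, degree_add, ih]; push_cast; ring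

lemma IsHyperelliptic.brillNoetherDim_eq (hΓ : Γ.IsHyperelliptic) (v₀ : Γ.V) {r d : ℕ}
    (hrd : 2 * r ≤ d) (hd : d < Γ.genus) :
    Γ.brillNoetherDim v₀ r d = (((d - 2 * r : ℕ) : ℝ≥0∞) : WithBot ℝ≥0∞) := by
  obtain ⟨D, hdeg, hrank, -⟩ := hΓ
  have hne : Nonempty Γ.E := nonempty_edge (by omega)
  obtain ⟨e, he⟩ := exists_tuple_finrank_sup_span_ge (V := Γ.JacCover) span_range_edgeDual ⊥ (d - 2 * r)
  rw [bot_sup_eq, finrank_bot, zero_add, finrank_jacCover, min_eq_right (by omega)] at he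
  refine MetricGraph.brillNoetherDim_eq v₀ hrd hd (e := e) (D := r • D)
    (linearIndependent_iff_card_le_finrank_span.2 (by simpa [Set.finrank] using he))
    (by rw [degree_nsmul, hdeg]; ring) fun t _ => hrank.nsmul_add (sum_edgePoint_nonneg e t) r

end MetricGraph

end

noncomputable section

namespace MetricGraph

/-! ### A cycle with loops attached at two points that are not conjugate -/

/-- A cycle of length `3`, consisting of the edge `0` of length `1` from `false` to `true` and the
edge `1` of length `2` from `true` to `false`, with one loop attached at `false` and two loops
attached at `true`. -/
def loopedCycle : MetricGraph.{0} where
  V := Bool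
  E := Fin 5
  src := ![false, true, false, true, true]
  tgt := ![true, false, false, true, true]
  len := ![1, 2, 1, 1, 1]
  len_pos e := by fin_cases e <;> simp
  connected := by
    have h : Relation.EqvGen (fun a b : Bool => ∃ e : Fin 5,
        (![false, true, false, true, true] : Fin 5 → Bool) e = a ∧
        (![true, false, false, true, true] : Fin 5 → Bool) e = b) false true :=
      .rel _ _ ⟨0, rfl, rfl⟩
    rintro (_ | _) (_ | _)
    exacts [.refl _, h, h.symm, .refl _]

namespace loopedCycle

/-- The edges of `loopedCycle`. -/
abbrev edge (i : Fin 5) : loopedCycle.E := i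

/-- The vertices of `loopedCycle`. -/
abbrev vertex (b : Bool) : loopedCycle.V := b

/-! ### Homology of the looped cycle -/

lemma sum_edge {M : Type*} [AddCommMonoid M] (f : loopedCycle.E → M) :
    ∑ e, f e = f (edge 0) + f (edge 1) + f (edge 2) + f (edge 3) + f (edge 4) :=
  Fin.sum_univ_five f

lemma boundary_false (R : Type*) [CommRing R] (c : loopedCycle.E → R) :
    loopedCycle.boundary R c (vertex false) = c (edge 1) - c (edge 0) := by
  simp only [boundary, LinearMap.coe_mk, AddHom.coe_mk, sum_edge]
  simp [loopedCycle, edge]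
  ring

lemma boundary_true (R : Type*) [CommRing R] (c : loopedCycle.E → R) :
    loopedCycle.boundary R c (vertex true) = c (edge 0) - c (edge 1) := by
  simp only [boundary, LinearMap.coe_mk, AddHom.coe_mk, sum_edge]
  simp [loopedCycle, edge]
  ring

lemma boundary_eq_zero_iff {R : Type*} [CommRing R] {c : loopedCycle.E → R} :
    loopedCycle.boundary R c = 0 ↔ c (edge 0) = c (edge 1) := by
  constructor
  · intro h
    have := congrFun h (vertex false)
    rw [boundary_false] at this
    exact (sub_eq_zero.1 this).symm
  · intro h
    funext b
    rcases b with _ | _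
    · exact (boundary_false R c).trans (by rw [h, sub_self]; rfl)
    · exact (boundary_true R c).trans (by rw [h, sub_self]; rfl)

lemma three_lt_genus : 3 < loopedCycle.genus := by
  -- The two edges of the cycle share a coordinate, so pulling back along `j` produces cycles.
  let j : Fin 5 → Fin 4 := ![0, 0, 1, 2, 3]
  have hj : Function.Surjective j := by decide
  let φ : (Fin 4 → ℝ) →ₗ[ℝ] (loopedCycle.E → ℝ) := LinearMap.funLeft ℝ ℝ j
  have hφ : ∀ x, φ x ∈ loopedCycle.H1 := fun x =>
    LinearMap.mem_ker.2 (boundary_eq_zero_iff.2 rfl)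
  have hinj : Function.Injective (φ.codRestrict loopedCycle.H1 hφ) := fun x y h =>
    LinearMap.funLeft_injective_of_surjective ℝ ℝ j hj (congrArg Subtype.val h)
  have := LinearMap.finrank_le_finrank_of_injective hinj
  rw [Module.finrank_fin_fun] at this
  exact this

lemma edgeDual_one : edgeDual (edge 1) = edgeDual (edge 0) := by
  ext ω
  exact (boundary_eq_zero_iff.1 (LinearMap.mem_ker.1 ω.2)).symm

lemma len_edge (i : Fin 5) : loopedCycle.len (edge i) = (![1, 2, 1, 1, 1] : Fin 5 → ℝ) i := rfl

lemma edge_inj {i j : Fin 5} : edge i = edge j ↔ i = j := Iff.rfl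

/-- The harmonic form supported on the cycle. -/
def cycleForm : loopedCycle.H1 :=
  ⟨fun e => if e = edge 0 ∨ e = edge 1 then 1 else 0,
    LinearMap.mem_ker.2 (boundary_eq_zero_iff.2 (by simp))⟩

lemma cycleForm_apply (e : loopedCycle.E) :
    (cycleForm : loopedCycle.E → ℝ) e = if e = edge 0 ∨ e = edge 1 then 1 else 0 := rfl

/-- The harmonic form supported on a loop. -/
def loopForm (l : Fin 5) (h0 : l ≠ 0) (h1 : l ≠ 1) : loopedCycle.H1 :=
  ⟨fun e => if e = edge l then 1 else 0, LinearMap.mem_ker.2 (boundary_eq_zero_iff.2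
    (by rw [if_neg (mt edge_inj.1 h0.symm), if_neg (mt edge_inj.1 h1.symm)]))⟩

lemma loopForm_apply (l : Fin 5) (h0 : l ≠ 0) (h1 : l ≠ 1) (e : loopedCycle.E) :
    (loopForm l h0 h1 : loopedCycle.E → ℝ) e = if e = edge l then 1 else 0 := rfl

lemma len_loop {l : Fin 5} (h0 : l ≠ 0) (h1 : l ≠ 1) : loopedCycle.len (edge l) = 1 := by
  rw [len_edge]
  fin_cases l <;> simp_all

lemma chainDual_cycleForm (c : loopedCycle.E → ℤ) :
    chainDual c cycleForm = c (edge 0) + c (edge 1) * 2 := by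
  rw [chainDual_apply, sum_edge]
  simp only [cycleForm_apply, len_edge, edge_inj]
  simp

lemma chainDual_loopForm (c : loopedCycle.E → ℤ) (l : Fin 5) (h0 : l ≠ 0) (h1 : l ≠ 1) :
    chainDual c (loopForm l h0 h1) = c (edge l) := by
  rw [chainDual_apply, Finset.sum_eq_single (edge l)]
  · rw [loopForm_apply, if_pos rfl, len_loop h0 h1, mul_one, mul_one]
  · intro e _ he
    rw [loopForm_apply, if_neg he, mul_zero]
  · simp

/-! ### Divisors on the looped cycle -/

/-- The position of a vertex on the cycle. -/
def vertexCoord (v : loopedCycle.V) : ℝ := if v = vertex false then 0 else 1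

@[simp] lemma vertexCoord_false : vertexCoord (vertex false) = 0 := if_pos rfl

@[simp] lemma vertexCoord_true : vertexCoord (vertex true) = 1 :=
  if_neg (Bool.false_ne_true ∘ Eq.symm)

lemma isAbelJacobiLift_vertex (v : loopedCycle.V) :
    IsAbelJacobiLift (vertex false) (Finsupp.single (Sum.inl v) 1)
      (vertexCoord v • edgeDual (edge 0)) := by
  have h0 : IsAbelJacobiLift (vertex false) (Finsupp.single (Sum.inl (vertex false)) 1)
      (0 : loopedCycle.JacCover) := by
    have := isAbelJacobiLift_single (v₀ := vertex false) (x := Sum.inl (vertex false)) (c := 0)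
      (by simp [root])
    simpa [chainDual, rootDual] using this
  rcases v with _ | _
  · change IsAbelJacobiLift _ (Finsupp.single (Sum.inl (vertex false)) 1)
      (vertexCoord (vertex false) • _)
    rw [vertexCoord_false, zero_smul]
    exact h0
  · change IsAbelJacobiLift _ (Finsupp.single (Sum.inl (vertex true)) 1)
      (vertexCoord (vertex true) • _)
    have h1 := IsAbelJacobiLift.edgePoint (e := edge 0) h0
      (t := loopedCycle.len (edge 0)) ⟨(loopedCycle.len_pos _).le, le_rfl⟩
    rw [edgePoint_len, zero_add] at h1
    rw [vertexCoord_true]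
    exact h1

lemma exists_isAbelJacobiLift_smul (θ : ℝ) : ∃ y, IsAbelJacobiLift (vertex false)
    (Finsupp.single y 1) (θ • edgeDual (edge 0)) := by
  -- Reduce `θ` modulo 3, the length of the cycle; `[0, 1]` is then covered by edge `0` and `[1, 3]`
  -- by edge `1`.
  let k : ℤ := ⌊θ / 3⌋
  have hk : (k : ℝ) ≤ θ / 3 := Int.floor_le _
  have hk' : θ / 3 < k + 1 := Int.lt_floor_add_one _
  have hc : loopedCycle.boundary ℤ (fun e => if e = edge 0 ∨ e = edge 1 then k else 0) = 0 :=
    boundary_eq_zero_iff.2 (by simp)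
  have hlat := isAbelJacobiLift_chainDual (vertex false) hc
  have hval : chainDual (Γ := loopedCycle) (fun e => if e = edge 0 ∨ e = edge 1 then k else 0) =
      (3 * k : ℝ) • edgeDual (edge 0) := by
    rw [chainDual, sum_edge, edgeDual_one]
    simp only [len_edge, edge_inj]
    ext ω
    simp
    ring
  rw [hval] at hlat
  obtain ⟨y, hy⟩ : ∃ y, IsAbelJacobiLift (vertex false) (Finsupp.single y 1)
      ((θ - 3 * k) • edgeDual (edge 0)) := by
    by_cases h1 : θ - 3 * k ≤ 1
    · have := IsAbelJacobiLift.edgePoint (e := edge 0) (isAbelJacobiLift_vertex (vertex false))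
        (t := θ - 3 * k) ⟨by linarith, by simpa [len_edge] using h1⟩
      exact ⟨_, by simpa using this⟩
    · have := IsAbelJacobiLift.edgePoint (e := edge 1) (isAbelJacobiLift_vertex (vertex true))
        (t := θ - 3 * k - 1) ⟨by linarith, by simp only [len_edge]; simp; linarith⟩
      rw [edgeDual_one, ← add_smul] at this
      exact ⟨_, by simpa using this⟩
  refine ⟨y, ?_⟩
  have := hy.add hlat
  rw [← add_smul, add_zero] at this
  simpa using this

/-- On a loop the partner is the mirror image, which cancels the loop component modulo the lattice.
Elsewhere that component is absent and a vertex will do. -/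
lemma exists_partner (x : loopedCycle.Point) : ∃ (x' : loopedCycle.Point) (s : ℝ),
    IsAbelJacobiLift (vertex false) (Finsupp.single x 1 + Finsupp.single x' 1)
      (s • edgeDual (edge 0)) := by
  rcases x with b | ⟨e, t, ht⟩
  · have := (isAbelJacobiLift_vertex b).add (isAbelJacobiLift_vertex (vertex false))
    rw [← add_smul] at this
    exact ⟨_, _, this⟩
  have hx := IsAbelJacobiLift.edgePoint (isAbelJacobiLift_vertex (loopedCycle.src e))
    ⟨ht.1.le, ht.2.le⟩
  rw [edgePoint_of_mem ht] at hx
  by_cases he : e = edge 0 ∨ e = edge 1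
  · have hu : edgeDual e = edgeDual (edge 0) := by
      rcases he with rfl | rfl
      · rfl
      · exact edgeDual_one
    have := hx.add (isAbelJacobiLift_vertex (vertex false))
    rw [hu, ← add_smul, ← add_smul] at this
    exact ⟨_, _, this⟩
  · rw [not_or] at he
    have hx' := IsAbelJacobiLift.edgePoint (e := e) (t := loopedCycle.len e - t)
      (isAbelJacobiLift_vertex (loopedCycle.src e))
      ⟨by linarith [ht.2], by linarith [ht.1]⟩
    have hc : loopedCycle.boundary ℤ (Pi.single e (-1)) = 0 :=
      boundary_eq_zero_iff.2 (by rw [Pi.single_eq_of_ne' he.1, Pi.single_eq_of_ne' he.2])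
    have hlat := isAbelJacobiLift_chainDual (vertex false) hc
    have hval : chainDual (Pi.single e (-1)) = -(loopedCycle.len e) • edgeDual e := by
      rw [chainDual, Finset.sum_eq_single e] <;> simp +contextual
    rw [hval] at hlat
    have := (hx.add hx').add hlat
    rw [add_zero] at this
    refine ⟨loopedCycle.edgePoint e (loopedCycle.len e - t), vertexCoord (loopedCycle.src e) +
      vertexCoord (loopedCycle.src e), ?_⟩
    convert this using 1
    ext ω
    simp
    ring

/-- With `x'` the partner of `x`, the class of `D - x - x'` has degree 1 and points along the cycle,
so it is the class of a point `y`. -/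
lemma rankAtLeast_one {D : loopedCycle.Divisor} (hdeg : degree D = 3) {θ : ℝ}
    (hD : IsAbelJacobiLift (vertex false) D (θ • edgeDual (edge 0))) : RankAtLeast D 1 := by
  intro E hE hEdeg
  obtain ⟨x, rfl⟩ := eq_single_of_degree_eq_one hE (by simpa using hEdeg)
  obtain ⟨x', s, hx⟩ := exists_partner x
  obtain ⟨y, hy⟩ := exists_isAbelJacobiLift_smul (θ - s)
  obtain ⟨ξ, hξ⟩ := exists_isAbelJacobiLift_single (vertex false) x
  refine ⟨Finsupp.single x' 1 + Finsupp.single y 1,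
    add_nonneg (single_nonneg x') (single_nonneg y),
    linearlyEquivalent_of_isAbelJacobiLift ?_ (hD.sub hξ) ?_⟩
  · rw [degree_sub, degree_add, hdeg]
    simp
  · convert (hx.sub hξ).add hy using 1
    · abel
    · ext ω
      simp
      ring

/-- Subtracting a generic point of the loop leaves an effective point that must lie on the same
loop. Neither point is seen by `cycleForm`, so on the cycle `D` looks like twice the base point of
the loop. -/
lemma exists_chain_of_loop {D : loopedCycle.Divisor} (hdeg : degree D = 2)
    (hD : RankAtLeast D 1) {ξ : loopedCycle.JacCover}
    (hξ : IsAbelJacobiLift (vertex false) D ξ) (l : Fin 5) (h0 : l ≠ 0) (h1 : l ≠ 1) :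
    ∃ c : loopedCycle.E → ℤ, loopedCycle.boundary ℤ c =
        Pi.single (loopedCycle.src (edge l)) 2 - Pi.single (vertex false) 2 ∧
      ξ cycleForm = c (edge 0) + c (edge 1) * 2 := by
  obtain ⟨t, ht, htξ⟩ : ∃ t ∈ Set.Ioo (0 : ℝ) (loopedCycle.len (edge l)),
      ∀ n : ℤ, ξ (loopForm l h0 h1) - t ≠ n := by
    rw [len_loop h0 h1]
    -- The parameters `1/3` and `2/3` do not differ by an integer, so one of them works.
    by_contra! hcon
    obtain ⟨n, hn⟩ := hcon (1 / 3) ⟨by norm_num, by norm_num⟩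
    obtain ⟨m, hm⟩ := hcon (2 / 3) ⟨by norm_num, by norm_num⟩
    have : (3 * (n - m) : ℝ) = 1 := by linarith
    have : 3 * (n - m) = 1 := by exact_mod_cast this
    omega
  obtain ⟨a, ha⟩ := exists_boundary_eq (vertex false) (loopedCycle.src (edge l))
  have hx := isAbelJacobiLift_single (x := Sum.inr ⟨edge l, ⟨t, ht⟩⟩) ha
  obtain ⟨D', hD', hequiv⟩ := hD _ (single_nonneg (Sum.inr ⟨edge l, ⟨t, ht⟩⟩)) (by simp)
  obtain ⟨x', rfl⟩ := eq_single_of_degree_eq_one hD'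
    (by rw [hequiv.degree_eq, degree_sub, hdeg]; simp)
  obtain ⟨b, hb, hval⟩ := isAbelJacobiLift_iff.1 (hequiv.isAbelJacobiLift (hξ.sub hx))
  rw [divisorDual_single] at hval
  have hev : ∀ ω, ξ ω = chainDual a ω + t * (ω : loopedCycle.E → ℝ) (edge l) + chainDual b ω +
      rootDual x' ω := fun ω => by
    have := congrArg (fun ζ : loopedCycle.JacCover => ζ ω) hval
    have hr : rootDual (Sum.inr ⟨edge l, ⟨t, ht⟩⟩ : loopedCycle.Point) ω =
      t * (ω : loopedCycle.E → ℝ) (edge l) := rfl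
    simp only [sub_apply, add_apply, hr, Int.cast_one, one_smul] at this
    linarith
  -- A point off the loop would make the loop coordinate of `ξ` minus `t` an integer, against the
  -- choice of `t`.
  obtain ⟨t', rfl⟩ : ∃ t', x' = Sum.inr ⟨edge l, t'⟩ := by
    by_contra! hcon
    have hzero : rootDual x' (loopForm l h0 h1) = 0 := by
      rcases x' with v | ⟨e, t'⟩
      · simp [rootDual]
      · have he : e ≠ edge l := by
          rintro rfl
          exact hcon t' rfl
        have : (loopForm l h0 h1 : loopedCycle.E → ℝ) e = 0 := if_neg he
        simp [rootDual, this]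
    have h2 := hev (loopForm l h0 h1)
    have h3 : (loopForm l h0 h1 : loopedCycle.E → ℝ) (edge l) = 1 := if_pos rfl
    rw [chainDual_loopForm, chainDual_loopForm, hzero, h3] at h2
    refine htξ (a (edge l) + b (edge l)) ?_
    push_cast
    linarith
  have hr : rootDegree (Finsupp.single (Sum.inr ⟨edge l, t'⟩ : loopedCycle.Point) 1) =
      Pi.single (loopedCycle.src (edge l)) 1 := by
    funext v
    rw [rootDegree_single, Pi.single_apply]
    simp [root, eq_comm]
  refine ⟨a + b, ?_, ?_⟩
  · rw [map_add, ha, hb, hr, degree_single]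
    rw [show (2 : ℤ) = 1 + 1 from rfl, Pi.single_add, Pi.single_add]
    abel
  · have h2 := hev cycleForm
    have h3 : (cycleForm : loopedCycle.E → ℝ) (edge l) = 0 := by
      rw [cycleForm_apply, if_neg (not_or.2 ⟨mt edge_inj.1 h0, mt edge_inj.1 h1⟩)]
    rw [chainDual_cycleForm, chainDual_cycleForm, h3] at h2
    simp only [rootDual, smul_apply, edgeDual_apply, h3, smul_zero, mul_zero, add_zero] at h2
    rw [h2]
    simp only [Pi.add_apply]
    push_cast
    ring

lemma not_isHyperelliptic : ¬ loopedCycle.IsHyperelliptic := by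
  rintro ⟨D, hdeg, hD, -⟩
  obtain ⟨ξ, hξ⟩ := exists_isAbelJacobiLift (vertex false) D
  obtain ⟨c, hc, hcξ⟩ := exists_chain_of_loop hdeg hD hξ 2 (by decide) (by decide)
  obtain ⟨c', hc', hcξ'⟩ := exists_chain_of_loop hdeg hD hξ 3 (by decide) (by decide)
  have h1 := congrFun hc (vertex false)
  have h2 := congrFun hc' (vertex false)
  rw [boundary_false] at h1 h2
  have e1 : loopedCycle.src (edge 2) = vertex false := rfl
  have e2 : loopedCycle.src (edge 3) = vertex true := rfl
  have e3 : vertex false ≠ vertex true := Bool.false_ne_true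
  rw [e1, sub_self, Pi.zero_apply] at h1
  rw [e2, Pi.sub_apply, Pi.single_eq_same, Pi.single_eq_of_ne e3] at h2
  have h3 : (c (edge 0) + c (edge 1) * 2 : ℝ) = c' (edge 0) + c' (edge 1) * 2 :=
    hcξ.symm.trans hcξ'
  have h4 : c (edge 0) + c (edge 1) * 2 = c' (edge 0) + c' (edge 1) * 2 := by exact_mod_cast h3
  -- The loop at `false` makes the cycle coordinate a multiple of 3; the one at `true` makes it `-4`
  -- modulo 3.
  omega

lemma edgeDual_ne_zero : edgeDual (edge 0) ≠ 0 := fun h => by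
  have h1 := congrArg (fun ξ : loopedCycle.JacCover => ξ cycleForm) h
  have h2 : (cycleForm : loopedCycle.E → ℝ) (edge 0) = 1 := by
    rw [cycleForm_apply, if_pos (Or.inl rfl)]
  simp only [edgeDual_apply, h2, zero_apply] at h1
  exact one_ne_zero h1

/-- The family is twice the vertex `false` plus a point moving on edge `0`. -/
lemma brillNoetherDim_one_three (v₀ : loopedCycle.V) :
    loopedCycle.brillNoetherDim v₀ 1 3 = (((3 - 2 * 1 : ℕ) : ℝ≥0∞) : WithBot ℝ≥0∞) := by
  have hli : LinearIndependent ℝ (edgeDual ∘ fun _ : Fin (3 - 2 * 1) => edge 0) := by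
    have h := LinearIndependent.of_subsingleton (R := ℝ) (M := loopedCycle.JacCover)
      (v := fun _ : Fin 1 => edgeDual (edge 0)) 0
    exact h edgeDual_ne_zero
  refine brillNoetherDim_eq v₀ (by norm_num) three_lt_genus hli
    (D := Finsupp.single (Sum.inl (vertex false)) 1 + Finsupp.single (Sum.inl (vertex false)) 1)
    (by rw [degree_add]; simp) fun t ht => ?_
  have h0 := isAbelJacobiLift_vertex (vertex false)
  have hsum : (∑ j, Finsupp.single (loopedCycle.edgePoint (edge 0) (t j)) 1 :
      loopedCycle.Divisor) = Finsupp.single (loopedCycle.edgePoint (edge 0) (t 0)) 1 :=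
    Fin.sum_univ_one fun j => Finsupp.single (loopedCycle.edgePoint (edge 0) (t j)) (1 : ℤ)
  rw [hsum]
  have h := (h0.add h0).add (h0.edgePoint (e := edge 0) ⟨(ht 0).1.le, (ht 0).2.le⟩)
  rw [← add_smul, ← add_smul, ← add_smul] at h
  exact rankAtLeast_one (by rw [degree_add, degree_add]; simp) h

end loopedCycle

end MetricGraph

end

theorem mainTheorem4 :
    (∀ (Γ : MetricGraph.{u}) (v₀ : Γ.V) (r d : ℕ), 0 < 2 * r → 2 * r ≤ d → d < Γ.genus →
      Γ.brillNoetherDim v₀ r d ≤ (((d - 2 * r : ℕ) : ℝ≥0∞) : WithBot ℝ≥0∞) ∧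
      (Γ.IsHyperelliptic →
        Γ.brillNoetherDim v₀ r d = (((d - 2 * r : ℕ) : ℝ≥0∞) : WithBot ℝ≥0∞))) ∧
    (∃ Γ : MetricGraph.{0}, ¬ Γ.IsHyperelliptic ∧
      ∃ r d : ℕ, 0 < 2 * r ∧ 2 * r ≤ d ∧ d < Γ.genus ∧
        ∀ v₀ : Γ.V,
          Γ.brillNoetherDim v₀ r d = (((d - 2 * r : ℕ) : ℝ≥0∞) : WithBot ℝ≥0∞)) := by
  refine ⟨fun Γ v₀ r d _ hrd hd => ⟨MetricGraph.brillNoetherDim_le v₀ hrd hd, fun hΓ =>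
    hΓ.brillNoetherDim_eq v₀ hrd hd⟩, MetricGraph.loopedCycle,
    MetricGraph.loopedCycle.not_isHyperelliptic, 1, 3, by norm_num, by norm_num,
    MetricGraph.loopedCycle.three_lt_genus,
    MetricGraph.loopedCycle.brillNoetherDim_one_three⟩
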